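/- For $n\ge 3$ define simplicial complexes $\Delta_1,\Delta_2,\dots$ of dimension $n-1$ as follows: $\Delta_1$ is the boundary of the $n$-simplex with vertices $1,\dots,n+1$, and $\Delta_{i+1}$ is obtained from $\Delta_i$ by subdividing the facet $\{i+1,\dots,n+i\}$ with a new vertex $n+i+1$ (that is, this facet is replaced by the $n$ facets consisting of $n+i+1$ and $n-1$ of its vertices). Thus $\Delta_{2n+2}$ is a stacked sphere (a complex obtained from the boundary of a simplex by repeatedly subdividing facets with new vertices), with vertices $1,\dots,3n+2$. Let $F=\{1,\dots,n\}$ and $G=\{2n+3,\dots,3n+2\}$, and consider two bijections $G\to F$: the straight one, $2n+2+j\mapsto j$ for $1\le j\le n$, and the exchanged one, which agrees with it except that $3n+1\mapsto n$ and $3n+2\mapsto n-1$. The nonorientable $S^m$-bundle over $S^1$ ($m\ge1$) is the quotient of $S^m\times[0,1]$ by $(x,0)\sim(\rho x,1)$, where $\rho$ is a reflection of $S^m$ in a hyperplane; it is the total space of a locally trivial $S^m$-bundle over $S^1$ and is nonorientable, and a triangulation of it has no coherent orientation of its facets. A triangulation of a space $X$ is a simplicial complex whose geometric realization is homeomorphic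 to $X$. **Theorem.** (a) For every $n\ge3$, $F$ and $G$ are disjoint facets of the stacked sphere $\Delta_{2n+2}$; for each of the two bijections every path in $\Delta_{2n+2}$ between two vertices that correspond to each other has length at least three; and the bijections have opposite orientations: for a coherent orientation of $\Delta_{2n+2}$, the straight one reverses the orientations of the facets $G$ and $F$, and the exchanged one preserves them. Identifying corresponding vertices of $G$ and $F$ in $\Delta_{2n+2}$ and then removing the identified facet yields, for the straight bijection, a triangulation of $S^{n-2}\times S^1$ with $2n+2$ vertices, and, for the exchanged bijection, a triangulation of the nonorientable $S^{n-2}$-bundle over $S^1$ with $2n+2$ vertices. (b) Consequently, for every $k\ge1$ there exists a triangulation of $S^{2k}\times S^1$ with $4k+6$ vertices, and for every $k\ge0$ there exists a triangulation of the nonorientable $S^{2k+1}$-bundle over $S^1$ with $4k+8$ vertices. -/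

import Mathlib

namespace SphereBundles

open Finset

/-! ### Simplicial complexes

A simplicial complex is Mathlib's `PreAbstractSimplicialComplex V`: a set of nonempty finite
subsets of `V` (the faces), closed under passing to nonempty subsets. -/

section Complexes

variable {V : Type*}

/-- The vertices of a complex. -/
def vertices (K : PreAbstractSimplicialComplex V) : Set V :=
  {v | {v} ∈ K.faces}

/-- The facets (maximal faces) of a complex. -/
def facets (K : PreAbstractSimplicialComplex V) : Set (Finset V) :=
  {s | s ∈ K.faces ∧ ∀ t ∈ K.faces, s ⊆ t → s = t}

/-- The `1`-skeleton of a complex, as a graph. -/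
def skeletonGraph [DecidableEq V] (K : PreAbstractSimplicialComplex V) : SimpleGraph V where
  Adj u v := u ≠ v ∧ ({u, v} : Finset V) ∈ K.faces
  symm := ⟨fun u v h => ⟨h.1.symm, by rw [Finset.pair_comm]; exact h.2⟩⟩
  loopless := ⟨fun _ h => h.1 rfl⟩

/-- The geometric realization: the union, over all faces `s`, of the convex hull of the standard
basis vectors `e_v`, `v ∈ s`. (For a complex with finitely many vertices, the topology induced by
`V → ℝ` is that of the Euclidean space spanned by the `e_v`, `v` a vertex.) -/
def realization [DecidableEq V] (K : PreAbstractSimplicialComplex V) : Set (V → ℝ) :=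
  ⋃ s ∈ K.faces, convexHull ℝ ((fun v => (Pi.single v 1 : V → ℝ)) '' (s : Set V))

/-- `K` is a triangulation of the topological space `X`. -/
def IsTriangulation [DecidableEq V] (K : PreAbstractSimplicialComplex V)
    (X : Type*) [TopologicalSpace X] : Prop :=
  Nonempty (realization K ≃ₜ X)

/-- The boundary of the simplex with vertex set `A`. -/
def simplexBoundary (A : Finset V) : PreAbstractSimplicialComplex V where
  faces := {s | s.Nonempty ∧ s ⊂ A}
  isRelLowerSet_faces := fun _ hs =>
    ⟨hs.1, fun _ hts ht => ⟨ht, lt_of_le_of_lt hts hs.2⟩⟩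

/-- Subdivide the facet `F` of `K` with the new vertex `v`: the facet `F` is replaced by the
facets `{v} ∪ (F \ {x})`, `x ∈ F`. -/
def subdivideFacet [DecidableEq V] (K : PreAbstractSimplicialComplex V) (F : Finset V) (v : V) :
    PreAbstractSimplicialComplex V where
  faces := {s | (s ∈ K.faces ∧ ¬ F ⊆ s) ∨ (v ∈ s ∧ s.erase v ⊂ F) ∨ (s.Nonempty ∧ s ⊂ F)}
  isRelLowerSet_faces := by
    intro s hs
    rcases hs with ⟨hs, hF⟩ | ⟨hv, hs⟩ | ⟨hn, hs⟩
    · exact ⟨(K.isRelLowerSet_faces hs).1, fun t hts ht =>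
        Or.inl ⟨(K.isRelLowerSet_faces hs).2 hts ht, fun h => hF (h.trans hts)⟩⟩
    · refine ⟨⟨v, hv⟩, fun t hts ht => ?_⟩
      by_cases hvt : v ∈ t
      · exact Or.inr (Or.inl ⟨hvt, lt_of_le_of_lt (Finset.erase_subset_erase v hts) hs⟩)
      · refine Or.inr (Or.inr ⟨ht, lt_of_le_of_lt ?_ hs⟩)
        intro x hx
        exact Finset.mem_erase.2 ⟨fun h => hvt (h ▸ hx), hts hx⟩
    · exact ⟨hn, fun t hts ht => Or.inr (Or.inr ⟨ht, lt_of_le_of_lt hts hs⟩)⟩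

/-- Stacked spheres of dimension `n - 1`: start with the boundary of an `n`-simplex and repeatedly
subdivide facets with new vertices. -/
inductive IsStackedSphere [DecidableEq V] (n : ℕ) : PreAbstractSimplicialComplex V → Prop
  | simplex (A : Finset V) (hA : A.card = n + 1) : IsStackedSphere n (simplexBoundary A)
  | subdivide (K : PreAbstractSimplicialComplex V) (F : Finset V) (v : V)
      (hK : IsStackedSphere n K) (hF : F ∈ facets K) (hv : v ∉ vertices K) :
      IsStackedSphere n (subdivideFacet K F v)

/-- Remove the face `F` (and every face containing it) from `K`. -/
def removeFace (K : PreAbstractSimplicialComplex V) (F : Finset V) :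
    PreAbstractSimplicialComplex V where
  faces := {s | s ∈ K.faces ∧ ¬ F ⊆ s}
  isRelLowerSet_faces := fun _ hs => ⟨(K.isRelLowerSet_faces hs.1).1, fun _ hts ht =>
    ⟨(K.isRelLowerSet_faces hs.1).2 hts ht, fun h => hs.2 (h.trans hts)⟩⟩

/-- The complex obtained from `K` by identifying each vertex `x` of the facet `G` with the vertex
`ψ x` of the facet `F` and then removing the identified facet. -/
def handleAddition [DecidableEq V] (K : PreAbstractSimplicialComplex V) (F G : Finset V)
    (ψ : V → V) : PreAbstractSimplicialComplex V :=
  removeFace (K.map fun x => if x ∈ G then ψ x else x) F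

/-- The conditions under which a handle may be added: `F` and `G` are disjoint facets, `ψ` is a
bijection from `G` to `F`, and there is no path of length less than three between identified
vertices. -/
structure IsHandleIdentification [DecidableEq V] (K : PreAbstractSimplicialComplex V)
    (F G : Finset V) (ψ : V → V) : Prop where
  left_facet : F ∈ facets K
  right_facet : G ∈ facets K
  disjoint : Disjoint F G
  bijOn : Set.BijOn ψ (G : Set V) (F : Set V)
  three_le_edist : ∀ x ∈ G, 3 ≤ (skeletonGraph K).edist x (ψ x)

/-! ### Orientations

A facet is oriented by `ε F = 1` if it carries the orientation given by the increasing order of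
its vertices, and by `ε F = -1` if it carries the opposite orientation. -/

/-- The incidence number of the face `r` in `insert v r` (`v ∉ r`), both ordered increasingly. -/
def incidence [LinearOrder V] (r : Finset V) (v : V) : ℤˣ :=
  (-1) ^ (r.filter (fun x => x < v)).card

/-- `ε` orients the facets of `K`, all of which have `n` vertices, coherently: any two facets that
meet in `n - 1` vertices induce opposite orientations on their intersection. -/
def IsCoherentOrientation [LinearOrder V] (n : ℕ) (K : PreAbstractSimplicialComplex V)
    (ε : Finset V → ℤˣ) : Prop :=
  ∀ (r : Finset V) (v w : V), r.card + 1 = n → v ∉ r → w ∉ r → v ≠ w →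
    insert v r ∈ K.faces → insert w r ∈ K.faces →
    ε (insert v r) * incidence r v = -(ε (insert w r) * incidence r w)

/-- A pure `(n - 1)`-dimensional complex is orientable if it has a coherent orientation. -/
def IsOrientable [LinearOrder V] (n : ℕ) (K : PreAbstractSimplicialComplex V) : Prop :=
  ∃ ε : Finset V → ℤˣ, IsCoherentOrientation n K ε

/-- The sign of an injective map `ψ` on the finite set `G` with respect to the increasing orders on
`G` and on its image: `-1` to the number of inversions. -/
def inversionSign [LinearOrder V] (G : Finset V) (ψ : V → V) : ℤˣ :=
  (-1) ^ ((G ×ˢ G).filter (fun p => p.1 < p.2 ∧ ψ p.2 < ψ p.1)).card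

/-- The orientation of the identification `ψ` of the facet `G` with the facet `ψ(G)`, with respect
to `ε`: it is `1` if `ψ` preserves the orientations of these facets, `-1` if it reverses them. -/
def orientationSign [LinearOrder V] (ε : Finset V → ℤˣ) (G : Finset V) (ψ : V → V) : ℤˣ :=
  ε G * inversionSign G ψ * ε (G.image ψ)

end Complexes

/-! ### Sphere bundles over the circle -/

/-- The unit sphere `S^m` in `ℝ^(m+1)`. -/
abbrev Sphere (m : ℕ) : Type :=
  Metric.sphere (0 : EuclideanSpace ℝ (Fin (m + 1))) 1

/-- The gluing `(x, 0) ∼ (ρ x, 1)` on `S^m × [0, 1]`, where `ρ` is the reflection that changes the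
sign of the first coordinate. -/
def TwistRel (m : ℕ) (a b : Sphere m × unitInterval) : Prop :=
  a.2 = 0 ∧ b.2 = 1 ∧ b.1.1 0 = - a.1.1 0 ∧ ∀ j : Fin (m + 1), j ≠ 0 → b.1.1 j = a.1.1 j

/-- The twisted product of `S^m` and `S^1`: the quotient of `S^m × [0, 1]` by the equivalence
relation generated by `(x, 0) ∼ (ρ x, 1)`, with the quotient topology. -/
abbrev TwistedProduct (m : ℕ) : Type :=
  Quot (TwistRel m)

/-- `X` is the total space of a locally trivial bundle over `S^1` with fiber `S^m`. -/
def IsSphereBundleOverCircle (m : ℕ) (X : Type*) [TopologicalSpace X] : Prop :=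
  ∃ p : X → Circle, Continuous p ∧
    ∀ b : Circle, ∃ e : Bundle.Trivialization (Sphere m) p, b ∈ e.baseSet

/-- `K` is a triangulation of the nonorientable `S^m`-bundle over `S^1`: its realization is
homeomorphic to the twisted product of `S^m` and `S^1`, is an `S^m`-bundle over `S^1`, and the
`(m + 1)`-dimensional complex `K` is not orientable. -/
def TriangulatesNonorientableSphereBundle {V : Type*} [LinearOrder V] (m : ℕ)
    (K : PreAbstractSimplicialComplex V) : Prop :=
  IsTriangulation K (TwistedProduct m) ∧ IsSphereBundleOverCircle m (realization K) ∧
    ¬ IsOrientable (m + 2) K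

/-! ### The construction -/

/-- The stacked sphere `Δ_i` of dimension `n - 1`, `i ≥ 1`, with vertices `1, …, n + i`: `Δ_1` is
the boundary of the `n`-simplex on `1, …, n + 1`, and `Δ_(i+1)` is obtained from `Δ_i` by
subdividing the facet `{i + 1, …, n + i}` with the new vertex `n + i + 1`. -/
def Delta (n : ℕ) : ℕ → PreAbstractSimplicialComplex ℕ
  | 0 => ⊥
  | 1 => simplexBoundary (Finset.Icc 1 (n + 1))
  | i + 2 => subdivideFacet (Delta n (i + 1)) (Finset.Icc (i + 2) (n + i + 1)) (n + i + 2)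

/-- The facet `{1, …, n}` of `Δ_(2n+2)`. -/
def firstFacet (n : ℕ) : Finset ℕ := Finset.Icc 1 n

/-- The facet `{2n + 3, …, 3n + 2}` of `Δ_(2n+2)`. -/
def lastFacet (n : ℕ) : Finset ℕ := Finset.Icc (2 * n + 3) (3 * n + 2)

/-- The identification of `2n + 2 + j` with `j`, for `1 ≤ j ≤ n`. -/
def straightIdent (n : ℕ) (x : ℕ) : ℕ := x - (2 * n + 2)

/-- The same identification with the last two pairs exchanged: `2n + 2 + j` with `j` for
`1 ≤ j ≤ n - 2`, `3n + 1` with `n`, and `3n + 2` with `n - 1`. -/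
def exchangedIdent (n : ℕ) (x : ℕ) : ℕ := Equiv.swap (n - 1) n (straightIdent n x)

/-- The complex obtained from `Δ_(2n+2)` by the straight identification. -/
def straightISS (n : ℕ) : PreAbstractSimplicialComplex ℕ :=
  handleAddition (Delta n (2 * n + 2)) (firstFacet n) (lastFacet n) (straightIdent n)

/-- The complex obtained from `Δ_(2n+2)` by the exchanged identification. -/
def exchangedISS (n : ℕ) : PreAbstractSimplicialComplex ℕ :=
  handleAddition (Delta n (2 * n + 2)) (firstFacet n) (lastFacet n) (exchangedIdent n)

end SphereBundles

namespace SphereBundles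

open Finset

/-! ### Faces of a handle addition -/

section HandleIdentification

variable {V : Type*} [DecidableEq V] {K : PreAbstractSimplicialComplex V} {F G : Finset V}
  {ψ : V → V}

/-! `Delta n i` is the boundary of the ball stacked from the windows `{j, …, j + n}`, `1 ≤ j ≤ i`,
where consecutive windows share the facet `{j + 1, …, j + n}`; `mem_delta_faces` puts this in closed
form. An edge joins vertices that differ by at most `n`, while both identifications lower a vertex
of the last facet by at least `2n + 1`. So identified vertices are at distance at least three, which
makes the identification injective on each face and lets two distinct faces have the same image only
if one lies in `G` and the other in `F` (`image_eq_image`).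

For the topology, colour a vertex by its residue modulo `n`. In a window each colour occurs once,
except that the ends `j` and `j + n` share theirs. Adding coordinates by colour sends the stacked
sphere without the open facets `F` and `G` to the boundary of the simplex on `ZMod n`. The fibre
over `c` is an arc: lay intervals of lengths `c 0, c 1, …`, continued periodically, along a line and
slide a unit interval `[u, u + 1]` over them; the lengths it cuts off are the coordinates of a point
(`stackPoint`). This gives `S^(n-2) × [0, 1]`, with ends the boundaries of `F` and `G`, and the
identification glues the ends by a permutation of the colours (`handlePath_eq_iff`).

Modulo `n` the straight identification is `k ↦ k - 2`, the square of a permutation, hence even; the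
exchanged one has one more transposition, hence is odd. On the hyperplane of coordinate sum zero a
transposition is a reflection, and in dimension above one all reflections are isotopic. Isotopic
gluing maps give the same quotient, so only the parity counts: the gluing is by the identity or by
one reflection (`exists_isGluing_of_sign`).

Nonorientability is combinatorial. A coherent orientation of the handle addition, pulled back to the
stacked sphere, differs from the boundary orientation of the ball by one constant sign on all facets
except `F` and `G` (`orientationRatio_const`). Passing through the handle reverses that sign when
the identification preserves orientations (`ratio_eq_neg`).

Part (b) consists of the cases `n = 2k + 2` and `n = 2k + 3`. -/

/-- The vertex map of a handle addition. -/
def identMap (G : Finset V) (ψ : V → V) (x : V) : V := if x ∈ G then ψ x else x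

lemma pair_mem_faces {σ : Finset V} (hσ : σ ∈ K.faces) {x y : V} (hx : x ∈ σ) (hy : y ∈ σ) :
    ({x, y} : Finset V) ∈ K.faces := by
  refine (K.isRelLowerSet_faces hσ).2 ?_ ⟨x, by simp⟩
  intro z hz
  rcases mem_insert.1 hz with rfl | hz
  · exact hx
  · rwa [mem_singleton.1 hz]

lemma edist_le_one_of_mem {σ : Finset V} (hσ : σ ∈ K.faces) {x y : V} (hx : x ∈ σ) (hy : y ∈ σ) :
    (skeletonGraph K).edist x y ≤ 1 := by
  rw [SimpleGraph.edist_le_one_iff_adj_or_eq]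
  by_cases h : x = y
  · exact Or.inr h
  · exact Or.inl ⟨h, pair_mem_faces hσ hx hy⟩

/-- Otherwise `x`, `z`, `ψ x` would be a path of length at most two. The distance condition enters
only through this lemma. -/
lemma IsHandleIdentification.not_path (H : IsHandleIdentification K F G ψ) {σ τ : Finset V}
    (hσ : σ ∈ K.faces) (hτ : τ ∈ K.faces) {x z : V} (hx : x ∈ G) (hxσ : x ∈ σ) (hzσ : z ∈ σ)
    (hzτ : z ∈ τ) (hxτ : ψ x ∈ τ) : False := by
  have h := (H.three_le_edist x hx).trans (SimpleGraph.edist_triangle (v := z))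
  have h1 := edist_le_one_of_mem hσ hxσ hzσ
  have h2 := edist_le_one_of_mem hτ hzτ hxτ
  have h3 := h.trans (add_le_add h1 h2)
  norm_num at h3

lemma IsHandleIdentification.map_mem (H : IsHandleIdentification K F G ψ) {x : V} (hx : x ∈ G) :
    ψ x ∈ F := H.bijOn.mapsTo hx

lemma IsHandleIdentification.eq_or (H : IsHandleIdentification K F G ψ) {x y : V}
    (h : identMap G ψ x = identMap G ψ y) :
    x = y ∨ (x ∈ G ∧ y = ψ x) ∨ (y ∈ G ∧ x = ψ y) := by
  unfold identMap at h
  split_ifs at h with hx hy hy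
  · exact Or.inl (H.bijOn.injOn hx hy h)
  · exact Or.inr (Or.inl ⟨hx, h.symm⟩)
  · exact Or.inr (Or.inr ⟨hy, h⟩)
  · exact Or.inl h

lemma IsHandleIdentification.eq_of_common (H : IsHandleIdentification K F G ψ) {σ τ : Finset V}
    (hσ : σ ∈ K.faces) (hτ : τ ∈ K.faces) {x y z : V} (hx : x ∈ σ) (hzσ : z ∈ σ) (hzτ : z ∈ τ)
    (hy : y ∈ τ) (h : identMap G ψ x = identMap G ψ y) : x = y := by
  rcases H.eq_or h with h | ⟨hG, rfl⟩ | ⟨hG, rfl⟩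
  · exact h
  · exact (H.not_path hσ hτ hG hx hzσ hzτ hy).elim
  · exact (H.not_path hτ hσ hG hy hzτ hzσ hx).elim

lemma IsHandleIdentification.injOn (H : IsHandleIdentification K F G ψ) {σ : Finset V}
    (hσ : σ ∈ K.faces) : Set.InjOn (identMap G ψ) σ := fun _ hx _ hy h =>
  H.eq_of_common hσ hσ hx hx hx hy h

/-- One identified pair forces all the others. A vertex common to `σ` and `τ` would be the midpoint
of a short path from `x` to `ψ x`; a vertex of `τ` in `G` whose partner lies in `σ` would be joined
to that partner through `x`. -/
lemma IsHandleIdentification.subset_of_image_eq (H : IsHandleIdentification K F G ψ)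
    {σ τ : Finset V} (hσ : σ ∈ K.faces) (hτ : τ ∈ K.faces)
    (h : σ.image (identMap G ψ) = τ.image (identMap G ψ)) {x : V} (hx : x ∈ σ) (hxG : x ∈ G)
    (hxτ : ψ x ∈ τ) : σ ⊆ G ∧ τ ⊆ F := by
  have key : ∀ y ∈ σ, ∀ y' ∈ τ, identMap G ψ y = identMap G ψ y' → y ∈ G ∧ y' = ψ y := by
    intro y hy y' hy' hyy
    rcases H.eq_or hyy with rfl | h | ⟨h1, rfl⟩
    · exact (H.not_path hσ hτ hxG hx hy hy' hxτ).elim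
    · exact h
    · exact (H.not_path H.right_facet.1 hσ h1 h1 hxG hx hy).elim
  constructor
  · intro y hy
    have := mem_image_of_mem (identMap G ψ) hy
    rw [h, mem_image] at this
    obtain ⟨y', hy', e⟩ := this
    exact (key y hy y' hy' e.symm).1
  · intro y' hy'
    have := mem_image_of_mem (identMap G ψ) hy'
    rw [← h, mem_image] at this
    obtain ⟨y, hy, e⟩ := this
    obtain ⟨h1, rfl⟩ := key y hy y' hy' e
    exact H.map_mem h1

lemma IsHandleIdentification.image_eq_image (H : IsHandleIdentification K F G ψ)
    {σ τ : Finset V} (hσ : σ ∈ K.faces) (hτ : τ ∈ K.faces)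
    (h : σ.image (identMap G ψ) = τ.image (identMap G ψ)) :
    σ = τ ∨ (σ ⊆ G ∧ τ ⊆ F) ∨ (τ ⊆ G ∧ σ ⊆ F) := by
  by_cases hst : ∀ y ∈ σ, ∀ y' ∈ τ, identMap G ψ y = identMap G ψ y' → y = y'
  · left
    ext y
    constructor
    · intro hy
      have := mem_image_of_mem (identMap G ψ) hy
      rw [h, mem_image] at this
      obtain ⟨y', hy', e⟩ := this
      rwa [hst y hy y' hy' e.symm]
    · intro hy
      have := mem_image_of_mem (identMap G ψ) hy
      rw [← h, mem_image] at this
      obtain ⟨y', hy', e⟩ := this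
      rwa [← hst y' hy' y hy e]
  · push Not at hst
    obtain ⟨y, hy, y', hy', e, hne⟩ := hst
    rcases H.eq_or e with h1 | ⟨h1, rfl⟩ | ⟨h1, rfl⟩
    · exact (hne h1).elim
    · exact Or.inr (Or.inl (H.subset_of_image_eq hσ hτ h hy h1 hy'))
    · exact Or.inr (Or.inr (H.subset_of_image_eq hτ hσ h.symm hy' h1 hy))

lemma image_identMap {σ : Finset V}
    (hσ : σ ⊆ G) : σ.image (identMap G ψ) = σ.image ψ :=
  image_congr fun _ hx => if_pos (hσ hx)

lemma IsHandleIdentification.identMap_left (H : IsHandleIdentification K F G ψ) {x : V}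
    (hx : x ∈ F) : identMap G ψ x = x :=
  if_neg (disjoint_left.1 H.disjoint hx)

lemma IsHandleIdentification.image_left (H : IsHandleIdentification K F G ψ) {σ : Finset V}
    (hσ : σ ⊆ F) : σ.image (identMap G ψ) = σ := by
  rw [image_congr (g := fun x => x) fun x hx => H.identMap_left (hσ hx), image_id']

lemma IsHandleIdentification.image_facet (H : IsHandleIdentification K F G ψ) :
    G.image ψ = F := by
  rw [← coe_inj, coe_image]; exact H.bijOn.image_eq

/-- The faces of a handle addition are the images of the faces that do not contain `F` or `G`. -/
lemma IsHandleIdentification.mem_faces (H : IsHandleIdentification K F G ψ) {s : Finset V} :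
    s ∈ (handleAddition K F G ψ).faces ↔
      ∃ σ ∈ K.faces, ¬ F ⊆ σ ∧ ¬ G ⊆ σ ∧ σ.image (identMap G ψ) = s := by
  constructor
  · rintro ⟨⟨σ, hσ, rfl⟩, hF⟩
    refine ⟨σ, hσ, fun h => hF ?_, fun h => hF ?_, rfl⟩
    · have := image_subset_image (f := identMap G ψ) h
      rwa [H.image_left subset_rfl] at this
    · have := image_subset_image (f := identMap G ψ) h
      rwa [image_identMap subset_rfl, H.image_facet] at this
  · rintro ⟨σ, hσ, hF, hG, rfl⟩
    refine ⟨⟨σ, hσ, rfl⟩, fun h => ?_⟩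
    -- A part `τ` of `σ` that maps onto `F` has the same image as the face `F` itself, so it is `F`
    -- or `G`.
    obtain ⟨τ, hτσ, hτ⟩ := subset_image_iff.1 h
    have hne : F.Nonempty := (K.isRelLowerSet_faces H.left_facet.1).1
    have hτK : τ ∈ K.faces := by
      refine (K.isRelLowerSet_faces hσ).2 hτσ ?_
      rw [← hτ] at hne
      exact hne.of_image
    have h2 : τ.image (identMap G ψ) = F.image (identMap G ψ) := by
      rw [H.image_left subset_rfl]; exact hτ
    rcases H.image_eq_image hτK H.left_facet.1 h2 with rfl | ⟨h1, -⟩ | ⟨h1, -⟩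
    · exact hF hτσ
    · rw [image_identMap h1] at hτ
      have : τ = G := by
        refine Subset.antisymm h1 fun x hx => ?_
        have hx' := H.map_mem hx
        rw [← hτ] at hx'
        obtain ⟨y, hy, e⟩ := mem_image.1 hx'
        rwa [← H.bijOn.injOn (h1 hy) hx e]
      exact hG (this ▸ hτσ)
    · obtain ⟨x, hx⟩ := hne
      exact disjoint_left.1 H.disjoint hx (h1 hx)

end HandleIdentification

/-! ### The stacked spheres and the admissibility of the two identifications -/

section Delta

variable {n : ℕ}

/-- `s` is a proper face of the simplex on `{j, …, j + n}` that misses `x`, where the facets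
`{j + 1, …, j + n}` and `{j, …, j + n - 1}` are allowed for `j = i` and `j = 1` only. -/
structure IsDeltaFace (n i j x : ℕ) (s : Finset ℕ) : Prop where
  one_le : 1 ≤ j
  le : j ≤ i
  le_gap : j ≤ x
  gap_le : x ≤ j + n
  left : x = j → j = i
  right : x = j + n → j = 1
  mem : ∀ y ∈ s, j ≤ y ∧ y ≤ j + n ∧ y ≠ x

/-- These are the boundary faces of the stacked ball. Each subdivision makes the facet of the newest
window that misses its left end interior, so the only exposed facets missing an end of a window are
the one missing the left end of the last window and the one missing the right end of the first. -/
lemma mem_delta_faces {i : ℕ} (hi : 1 ≤ i) (hn : 2 ≤ n) {s : Finset ℕ} :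
    s ∈ (Delta n i).faces ↔ s.Nonempty ∧ ∃ j x, IsDeltaFace n i j x s := by
  induction i, hi using Nat.le_induction generalizing s with
  | base =>
    change s.Nonempty ∧ s ⊂ Icc 1 (n + 1) ↔ _
    refine and_congr_right fun _ => ⟨fun h => ?_, ?_⟩
    · obtain ⟨hs, x, hx, hxs⟩ := ssubset_iff_of_subset h.1 |>.1 h |> fun h' => And.intro h.1 h'
      rw [mem_Icc] at hx
      refine ⟨1, x, le_rfl, le_rfl, hx.1, by omega, fun _ => rfl, fun _ => rfl, fun y hy => ?_⟩
      have := mem_Icc.1 (hs hy)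
      exact ⟨this.1, by omega, fun e => hxs (e ▸ hy)⟩
    · rintro ⟨j, x, h⟩
      have := h.one_le; have := h.le; have := h.le_gap; have := h.gap_le
      obtain rfl : j = 1 := by omega
      refine (ssubset_iff_of_subset fun y hy => ?_).2 ⟨x, ?_, fun hx => (h.mem x hx).2.2 rfl⟩
      · have := h.mem y hy
        rw [mem_Icc]; omega
      · rw [mem_Icc]; omega
  | succ i hi ih =>
    obtain ⟨i, rfl⟩ : ∃ k, i = k + 1 := ⟨i - 1, by omega⟩
    change ((s ∈ (Delta n (i + 1)).faces ∧ ¬ Icc (i + 2) (n + i + 1) ⊆ s) ∨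
      (n + i + 2 ∈ s ∧ s.erase (n + i + 2) ⊂ Icc (i + 2) (n + i + 1)) ∨
      (s.Nonempty ∧ s ⊂ Icc (i + 2) (n + i + 1))) ↔ _
    rw [ih]
    -- Every new face, and every proper face of the subdivided facet, belongs to the new window and
    -- misses some vertex `y` of the subdivided facet.
    have key : ∀ y, y ∈ Icc (i + 2) (n + i + 1) → y ∉ s →
        (∀ z ∈ s, i + 2 ≤ z ∧ z ≤ n + i + 2) → IsDeltaFace n (i + 1 + 1) (i + 2) y s := by
      intro y hy hys hs
      rw [mem_Icc] at hy
      refine ⟨by omega, le_rfl, hy.1, by omega, fun _ => rfl, fun _ => by omega, fun z hz => ?_⟩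
      have := hs z hz
      exact ⟨this.1, by omega, fun e => hys (e ▸ hz)⟩
    constructor
    · rintro (⟨⟨hne, j, x, h⟩, hF⟩ | ⟨hv, hs⟩ | ⟨hne, hs⟩)
      · refine ⟨hne, ?_⟩
        have := h.one_le; have := h.le; have := h.le_gap; have := h.gap_le
        by_cases hx : x = j
        · have hj := h.left hx
          obtain ⟨y, hy, hys⟩ := not_subset.1 hF
          refine ⟨_, y, key y hy hys fun z hz => ?_⟩
          have := h.mem z hz
          omega
        · exact ⟨j, x, { h with le := by omega, left := fun e => (hx e).elim }⟩
      · obtain ⟨y, hy, hys⟩ := (ssubset_iff_of_subset hs.1).1 hs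
        have hy' := mem_Icc.1 hy
        refine ⟨⟨_, hv⟩, _, y, key y hy (fun h => hys (mem_erase.2 ⟨by omega, h⟩)) fun z hz => ?_⟩
        by_cases hzv : z = n + i + 2
        · omega
        · have := mem_Icc.1 (hs.1 (mem_erase.2 ⟨hzv, hz⟩))
          omega
      · obtain ⟨y, hy, hys⟩ := (ssubset_iff_of_subset hs.1).1 hs
        refine ⟨hne, _, y, key y hy hys fun z hz => ?_⟩
        have := mem_Icc.1 (hs.1 hz)
        omega
    · rintro ⟨hne, j, x, h⟩
      have h1 := h.one_le; have h2 := h.le; have h3 := h.le_gap; have h4 := h.gap_le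
      have h5 := h.left; have h6 := h.right
      by_cases hj : j = i + 2
      · subst hj
        have hx : x ∈ Icc (i + 2) (n + i + 1) := mem_Icc.2 (by omega)
        right
        by_cases hv : n + i + 2 ∈ s
        · refine Or.inl ⟨hv, (ssubset_iff_of_subset fun y hy => ?_).2
            ⟨x, hx, fun hx => (h.mem x (mem_of_mem_erase hx)).2.2 rfl⟩⟩
          obtain ⟨hy1, hy2⟩ := mem_erase.1 hy
          have := h.mem y hy2
          exact mem_Icc.2 (by omega)
        · refine Or.inr ⟨hne, (ssubset_iff_of_subset fun y hy => ?_).2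
            ⟨x, hx, fun hx => (h.mem x hx).2.2 rfl⟩⟩
          have h7 := h.mem y hy
          have : y ≠ n + i + 2 := fun e => hv (e ▸ hy)
          exact mem_Icc.2 (by omega)
      · refine Or.inl ⟨⟨hne, j, x, { h with le := by omega, left := fun e => by omega }⟩, ?_⟩
        intro hF
        by_cases hj' : j = i + 1
        · exact (h.mem x (hF (mem_Icc.2 (by omega)))).2.2 rfl
        · have := h.mem (n + i + 1) (hF (mem_Icc.2 (by omega)))
          omega

lemma IsDeltaFace.subset_erase {i j x : ℕ} {s : Finset ℕ} (h : IsDeltaFace n i j x s) :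
    s ⊆ (Icc j (j + n)).erase x := fun y hy =>
  mem_erase.2 ⟨(h.mem y hy).2.2, mem_Icc.2 ⟨(h.mem y hy).1, (h.mem y hy).2.1⟩⟩

lemma card_Icc_erase {j x : ℕ} (h1 : j ≤ x) (h2 : x ≤ j + n) :
    ((Icc j (j + n)).erase x).card = n := by
  rw [card_erase_of_mem (mem_Icc.2 ⟨h1, h2⟩), Nat.card_Icc]; omega

lemma IsDeltaFace.card_le {i j x : ℕ} {s : Finset ℕ} (h : IsDeltaFace n i j x s) :
    s.card ≤ n :=
  (card_le_card h.subset_erase).trans_eq (card_Icc_erase h.le_gap h.gap_le)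

lemma IsDeltaFace.eq_of_card {i j x : ℕ} {s : Finset ℕ} (h : IsDeltaFace n i j x s)
    (hs : s.card = n) : s = (Icc j (j + n)).erase x :=
  eq_of_subset_of_card_le h.subset_erase (by rw [hs, card_Icc_erase h.le_gap h.gap_le])

lemma mem_delta_facets {i : ℕ} (hi : 1 ≤ i) (hn : 2 ≤ n) {s : Finset ℕ}
    (hs : s ∈ (Delta n i).faces) (hc : s.card = n) : s ∈ facets (Delta n i) := by
  refine ⟨hs, fun t ht hst => eq_of_subset_of_card_le hst ?_⟩
  obtain ⟨-, j, x, h⟩ := (mem_delta_faces hi hn).1 ht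
  rw [hc]; exact h.card_le

lemma firstFacet_mem {i : ℕ} (hi : 1 ≤ i) (hn : 2 ≤ n) : firstFacet n ∈ facets (Delta n i) := by
  refine mem_delta_facets hi hn ((mem_delta_faces hi hn).2 ⟨⟨1, mem_Icc.2 (by omega)⟩, 1, n + 1,
    le_rfl, hi, by omega, by omega, fun _ => by omega, fun _ => rfl, fun y hy => ?_⟩)
    (by simp [firstFacet])
  have := mem_Icc.1 hy
  omega

lemma Icc_mem_facets {i : ℕ} (hi : 1 ≤ i) (hn : 2 ≤ n) :
    Icc (i + 1) (n + i) ∈ facets (Delta n i) := by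
  refine mem_delta_facets hi hn ((mem_delta_faces hi hn).2 ⟨⟨i + 1, mem_Icc.2 (by omega)⟩, i, i,
    hi, le_rfl, le_rfl, by omega, fun _ => rfl, fun _ => by omega, fun y hy => ?_⟩)
    (by simp)
  have := mem_Icc.1 hy
  omega

lemma mem_vertices_delta {i v : ℕ} (hi : 1 ≤ i) (hn : 2 ≤ n) :
    v ∈ vertices (Delta n i) ↔ 1 ≤ v ∧ v ≤ n + i := by
  change {v} ∈ (Delta n i).faces ↔ _
  rw [mem_delta_faces hi hn]
  constructor
  · rintro ⟨-, j, x, h⟩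
    have := h.mem v (mem_singleton_self v)
    have := h.one_le; have := h.le
    omega
  · rintro ⟨h1, h2⟩
    refine ⟨singleton_nonempty v, ?_⟩
    by_cases hv : v ≤ n
    · refine ⟨1, n + 1, le_rfl, hi, by omega, by omega, fun _ => by omega, fun _ => rfl,
        fun y hy => ?_⟩
      rw [mem_singleton.1 hy]; omega
    · by_cases hv' : v = n + 1
      · refine ⟨1, 2, le_rfl, hi, by omega, by omega, fun _ => by omega, fun _ => rfl,
          fun y hy => ?_⟩
        rw [mem_singleton.1 hy]; omega
      refine ⟨v - n, v - 1, by omega, by omega, by omega, by omega, fun _ => by omega,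
        fun _ => by omega, fun y hy => ?_⟩
      rw [mem_singleton.1 hy]; omega

lemma isStackedSphere_delta {i : ℕ} (hi : 1 ≤ i) (hn : 2 ≤ n) :
    IsStackedSphere n (Delta n i) := by
  induction i, hi using Nat.le_induction with
  | base => exact .simplex _ (by simp)
  | succ i hi ih =>
    obtain ⟨i, rfl⟩ : ∃ k, i = k + 1 := ⟨i - 1, by omega⟩
    refine .subdivide _ _ _ ih (Icc_mem_facets hi hn) fun h => ?_
    have := (mem_vertices_delta hi hn).1 h
    omega

lemma delta_adj {i u v : ℕ} (hi : 1 ≤ i) (hn : 2 ≤ n)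
    (h : (skeletonGraph (Delta n i)).Adj u v) : u ≤ v + n := by
  obtain ⟨-, j, x, h⟩ := (mem_delta_faces hi hn).1 h.2
  have h1 := h.mem u (by simp)
  have h2 := h.mem v (by simp)
  omega

/-- An edge stays inside one window, so two edges change a vertex by at most `2n`. -/
lemma three_le_edist_delta {i u v : ℕ} (hi : 1 ≤ i) (hn : 2 ≤ n) (h : v + 2 * n < u) :
    3 ≤ (skeletonGraph (Delta n i)).edist u v := by
  refine le_iInf fun p => ?_
  have key : ∀ {a b : ℕ} (p : (skeletonGraph (Delta n i)).Walk a b), a ≤ b + n * p.length := by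
    intro a b p
    induction p with
    | nil => simp
    | cons hadj p ih =>
      have := delta_adj hi hn hadj
      rw [SimpleGraph.Walk.length_cons, mul_add]
      omega
  have := key p
  by_contra hlt
  have h3 : p.length ≤ 2 := by
    rw [not_le] at hlt
    have : p.length < 3 := by exact_mod_cast hlt
    omega
  have := Nat.mul_le_mul_left n h3
  omega

lemma mem_lastFacet {x : ℕ} : x ∈ lastFacet n ↔ 2 * n + 3 ≤ x ∧ x ≤ 3 * n + 2 := mem_Icc

lemma mem_firstFacet {x : ℕ} : x ∈ firstFacet n ↔ 1 ≤ x ∧ x ≤ n := mem_Icc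

lemma bijOn_straightIdent :
    Set.BijOn (straightIdent n) (lastFacet n : Set ℕ) (firstFacet n : Set ℕ) := by
  refine ⟨fun x hx => ?_, fun x hx y hy h => ?_, fun y hy => ?_⟩
  · rw [mem_coe, mem_lastFacet] at hx
    rw [mem_coe, mem_firstFacet, straightIdent]; omega
  · rw [mem_coe, mem_lastFacet] at hx hy
    simp only [straightIdent] at h; omega
  · rw [mem_coe, mem_firstFacet] at hy
    exact ⟨y + (2 * n + 2), by rw [mem_coe, mem_lastFacet]; omega, by simp [straightIdent]⟩

lemma isHandleIdentification_delta (hn : 2 ≤ n) {ψ : ℕ → ℕ}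
    (hψ : Set.BijOn ψ (lastFacet n : Set ℕ) (firstFacet n : Set ℕ))
    (h : ∀ x ∈ lastFacet n, ψ x + 2 * n < x) :
    IsHandleIdentification (Delta n (2 * n + 2)) (firstFacet n) (lastFacet n) ψ where
  left_facet := firstFacet_mem (by omega) hn
  right_facet := by
    have := Icc_mem_facets (i := 2 * n + 2) (by omega) hn
    rwa [show n + (2 * n + 2) = 3 * n + 2 by omega] at this
  disjoint := disjoint_left.2 fun x h1 h2 => by
    rw [mem_firstFacet] at h1; rw [mem_lastFacet] at h2; omega
  bijOn := hψ
  three_le_edist := fun x hx => three_le_edist_delta (by omega) hn (h x hx)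

lemma isHandleIdentification_straight (hn : 2 ≤ n) :
    IsHandleIdentification (Delta n (2 * n + 2)) (firstFacet n) (lastFacet n)
      (straightIdent n) :=
  isHandleIdentification_delta hn bijOn_straightIdent fun x hx => by
    rw [mem_lastFacet] at hx; rw [straightIdent]; omega

lemma bijOn_swap (hn : 2 ≤ n) :
    Set.BijOn (Equiv.swap (n - 1) n) (firstFacet n : Set ℕ) (firstFacet n : Set ℕ) := by
  have key : ∀ x, x ∈ firstFacet n → Equiv.swap (n - 1) n x ∈ firstFacet n := by
    intro x hx
    rw [mem_firstFacet] at hx ⊢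
    rw [Equiv.swap_apply_def]
    split_ifs <;> omega
  exact ⟨key, (Equiv.injective _).injOn, fun x hx => ⟨_, key x hx, Equiv.swap_apply_self _ _ _⟩⟩

lemma isHandleIdentification_exchanged (hn : 2 ≤ n) :
    IsHandleIdentification (Delta n (2 * n + 2)) (firstFacet n) (lastFacet n)
      (exchangedIdent n) :=
  isHandleIdentification_delta hn ((bijOn_swap hn).comp bijOn_straightIdent) fun x hx => by
    rw [mem_lastFacet] at hx
    rw [exchangedIdent, Equiv.swap_apply_def, straightIdent]
    split_ifs <;> omega

lemma ncard_vertices_handleAddition (hn : 2 ≤ n) {ψ : ℕ → ℕ}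
    (H : IsHandleIdentification (Delta n (2 * n + 2)) (firstFacet n) (lastFacet n) ψ) :
    (vertices (handleAddition (Delta n (2 * n + 2)) (firstFacet n) (lastFacet n) ψ)).ncard =
      2 * n + 2 := by
  have : vertices (handleAddition (Delta n (2 * n + 2)) (firstFacet n) (lastFacet n) ψ) =
      (Icc 1 (2 * n + 2) : Finset ℕ) := by
    ext v
    change {v} ∈ (handleAddition _ _ _ ψ).faces ↔ _
    rw [H.mem_faces, mem_coe, mem_Icc]
    constructor
    · rintro ⟨σ, hσ, -, -, h⟩
      obtain ⟨x, hx⟩ := ((Delta n (2 * n + 2)).isRelLowerSet_faces hσ).1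
      have hv : identMap (lastFacet n) ψ x = v :=
        mem_singleton.1 (h ▸ mem_image_of_mem _ hx)
      have hx1 : x ∈ vertices (Delta n (2 * n + 2)) :=
        ((Delta n (2 * n + 2)).isRelLowerSet_faces hσ).2 (singleton_subset_iff.2 hx)
          (singleton_nonempty x)
      rw [mem_vertices_delta (by omega) hn] at hx1
      unfold identMap at hv
      split_ifs at hv with hxG
      · have := mem_firstFacet.1 (H.map_mem hxG)
        omega
      · rw [mem_lastFacet] at hxG; omega
    · rintro ⟨hv1, hv2⟩
      have hcard : ∀ s : Finset ℕ, s.card = n → ¬ s ⊆ {v} := fun s hs h => by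
        have := card_le_card h
        rw [card_singleton] at this; omega
      refine ⟨{v}, (mem_vertices_delta (i := 2 * n + 2) (by omega) hn).2 (by omega), hcard _ (by simp [firstFacet]),
        hcard _ (by simp [lastFacet]; omega), ?_⟩
      rw [image_singleton, identMap, if_neg]
      rw [mem_lastFacet]
      omega
  rw [this, Set.ncard_coe_finset]
  simp

end Delta

end SphereBundles
namespace SphereBundles

open Finset

/-! ### Orientations pulled back along a handle addition -/

section Orientation

section Signs

variable {V : Type*} [LinearOrder V]

/-- The sign of the pair `x, y` under a map: `-1` if it is inverted. -/
def pairSign (ψ : V → V) (x y : V) : ℤˣ := if x < y ∧ ψ y < ψ x then -1 else 1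

lemma neg_one_pow_card_filter {ι : Type*} (s : Finset ι) (p : ι → Prop) [DecidablePred p] :
    (-1 : ℤˣ) ^ (s.filter p).card = ∏ x ∈ s, if p x then -1 else 1 := by
  rw [prod_ite]; simp

lemma inversionSign_eq (G : Finset V) (ψ : V → V) :
    inversionSign G ψ = ∏ x ∈ G, ∏ y ∈ G, pairSign ψ x y := by
  rw [inversionSign, neg_one_pow_card_filter, prod_product]; rfl

lemma incidence_eq (r : Finset V) (v : V) :
    incidence r v = ∏ x ∈ r, if x < v then -1 else 1 :=
  neg_one_pow_card_filter _ _

/-- The pair of `v` and `x ∈ r` is inverted exactly when `x < v` and `φ x < φ v` disagree, so the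
signs match factor by factor. This is the compatibility of induced orientations with `φ`. -/
lemma inversionSign_insert {r : Finset V} {v : V} {φ : V → V} (hv : v ∉ r)
    (hφ : Set.InjOn φ (insert v r : Finset V)) :
    inversionSign (insert v r) φ * incidence r v =
      inversionSign r φ * incidence (r.image φ) (φ v) := by
  have h0 : pairSign φ v v = 1 := by simp [pairSign]
  rw [inversionSign_eq, inversionSign_eq, incidence_eq, incidence_eq,
    prod_image (hφ.mono (by simp)), prod_insert hv, prod_insert hv, h0, one_mul]
  have h1 : ∏ x ∈ r, ∏ y ∈ insert v r, pairSign φ x y =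
      (∏ x ∈ r, pairSign φ x v) * ∏ x ∈ r, ∏ y ∈ r, pairSign φ x y := by
    rw [← prod_mul_distrib]
    exact prod_congr rfl fun x _ => prod_insert hv
  have h2 : (∏ y ∈ r, pairSign φ v y) * (∏ x ∈ r, pairSign φ x v) *
      (∏ x ∈ r, if x < v then (-1 : ℤˣ) else 1) = ∏ x ∈ r, if φ x < φ v then (-1 : ℤˣ) else 1 := by
    rw [← prod_mul_distrib, ← prod_mul_distrib]
    refine prod_congr rfl fun x hx => ?_
    have hne : x ≠ v := fun h => hv (h ▸ hx)
    have hne' : φ x ≠ φ v := fun h =>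
      hne (hφ (by simp [hx]) (by simp) h)
    unfold pairSign
    rcases lt_or_gt_of_ne hne with h | h <;> rcases lt_or_gt_of_ne hne' with h' | h' <;>
      simp [h, h', h.not_gt, h'.not_gt]
  rw [h1, ← h2]
  ac_rfl

end Signs

section Handle

variable {V : Type*} [LinearOrder V] {K : PreAbstractSimplicialComplex V} {F G : Finset V}
  {ψ : V → V} {n : ℕ}

/-- Orientations of the facets of a handle addition, pulled back to the original complex. -/
def pullbackOrientation (ε : Finset V → ℤˣ) (φ : V → V) (s : Finset V) : ℤˣ :=
  ε (s.image φ) * inversionSign s φ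

/-- Two adjacent facets other than `F` and `G` stay adjacent in the handle addition, and the
inversion signs turn the incidence numbers of the images into those upstairs. Since `n ≥ 2` the
ridge has a vertex, which keeps the images of `v` and `w` distinct. -/
lemma IsHandleIdentification.pullback_coherent (H : IsHandleIdentification K F G ψ)
    (hn : 2 ≤ n) {ε : Finset V → ℤˣ} (hε : IsCoherentOrientation n (handleAddition K F G ψ) ε)
    {r : Finset V} {v w : V} (hr : r.card + 1 = n) (hv : v ∉ r) (hw : w ∉ r) (hvw : v ≠ w)
    (hvK : insert v r ∈ K.faces) (hwK : insert w r ∈ K.faces)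
    (hvF : ¬ F ⊆ insert v r) (hvG : ¬ G ⊆ insert v r)
    (hwF : ¬ F ⊆ insert w r) (hwG : ¬ G ⊆ insert w r) :
    pullbackOrientation ε (identMap G ψ) (insert v r) * incidence r v =
      -(pullbackOrientation ε (identMap G ψ) (insert w r) * incidence r w) := by
  obtain ⟨z, hz⟩ : r.Nonempty := card_pos.1 (by omega)
  have hiv := H.injOn hvK
  have hiw := H.injOn hwK
  have hir : Set.InjOn (identMap G ψ) r := hiv.mono (by simp)
  have hnot : ∀ u : V, u ∉ r → Set.InjOn (identMap G ψ) (insert u r : Finset V) →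
      identMap G ψ u ∉ r.image (identMap G ψ) := by
    intro u hu hi hm
    obtain ⟨y, hy, e⟩ := mem_image.1 hm
    exact hu (hi (mem_insert_of_mem hy) (mem_insert_self _ _) e ▸ hy)
  have := hε (r.image (identMap G ψ)) (identMap G ψ v) (identMap G ψ w)
    (by rw [card_image_of_injOn hir, hr]) (hnot v hv hiv) (hnot w hw hiw)
    (fun e => hvw (H.eq_of_common hvK hwK (mem_insert_self _ _) (mem_insert_of_mem hz)
      (mem_insert_of_mem hz) (mem_insert_self _ _) e))
    (H.mem_faces.2 ⟨_, hvK, hvF, hvG, image_insert _ _ _⟩)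
    (H.mem_faces.2 ⟨_, hwK, hwF, hwG, image_insert _ _ _⟩)
  rw [pullbackOrientation, pullbackOrientation, mul_assoc, mul_assoc, inversionSign_insert hv hiv,
    inversionSign_insert hw hiw, image_insert, image_insert, ← mul_assoc, ← mul_assoc,
    mul_right_comm, this, mul_right_comm (ε _) (inversionSign r _), neg_mul]

/-- The contradiction at a ridge: with a coherent orientation `ε₀` of `K` for which the
identification preserves orientations, the pulled back orientation changes sign with respect to
`ε₀` when one passes through the identified facet. -/
lemma IsHandleIdentification.ratio_eq_neg (H : IsHandleIdentification K F G ψ) (hn : 2 ≤ n)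
    {ε ε₀ : Finset V → ℤˣ} (hε : IsCoherentOrientation n (handleAddition K F G ψ) ε)
    (hε₀ : IsCoherentOrientation n K ε₀) (hsign : orientationSign ε₀ G ψ = 1)
    (hG : G.card = n) {r : Finset V} {g v w : V} (hg : g ∉ r) (hrG : insert g r = G)
    (hv : v ∉ F) (hvG : v ∉ G) (hw : w ∉ G) (hwF : w ∉ F) (hvw : v ≠ w)
    (hvK : insert v (r.image ψ) ∈ K.faces) (hwK : insert w r ∈ K.faces) :
    pullbackOrientation ε (identMap G ψ) (insert v (r.image ψ)) * ε₀ (insert v (r.image ψ)) =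
      -(pullbackOrientation ε (identMap G ψ) (insert w r) * ε₀ (insert w r)) := by
  have hrsub : r ⊆ G := hrG ▸ subset_insert _ _
  have hgG : g ∈ G := hrG ▸ mem_insert_self _ _
  have hr : r.card + 1 = n := by rw [← hG, ← hrG, card_insert_of_notMem hg]
  have hF : insert (ψ g) (r.image ψ) = F := by rw [← image_insert, hrG, H.image_facet]
  have hFsub : r.image ψ ⊆ F := hF ▸ subset_insert _ _
  have hφr : r.image (identMap G ψ) = r.image ψ := image_identMap hrsub
  have hψg : ψ g ∉ r.image ψ := fun hm => by
    obtain ⟨y, hy, e⟩ := mem_image.1 hm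
    exact hg (H.bijOn.injOn (hrsub hy) hgG e ▸ hy)
  have hvr : v ∉ r.image ψ := fun h => hv (hFsub h)
  have hwr : w ∉ r := fun h => hw (hrsub h)
  have hφv : identMap G ψ v = v := if_neg hvG
  have hφw : identMap G ψ w = w := if_neg hw
  have hcard : (r.image ψ).card + 1 = n := by
    rw [card_image_of_injOn (H.bijOn.injOn.mono (by exact_mod_cast hrsub)), hr]
  have hiv := H.injOn hvK
  have hiw := H.injOn hwK
  have himv : (insert v (r.image ψ)).image (identMap G ψ) = insert v (r.image ψ) := by
    rw [image_insert, hφv, H.image_left hFsub]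
  have himw : (insert w r).image (identMap G ψ) = insert w (r.image ψ) := by
    rw [image_insert, hφw, hφr]
  obtain ⟨z, hz⟩ : r.Nonempty := card_pos.1 (by omega)
  -- After the identification the neighbours of `F` and of `G` meet in the ridge `ψ(r)`. Before it,
  -- they meet `F` in `ψ(r)` and `G` in `r`; these are the relations `e2` and `e3`.
  have e1 := hε (r.image ψ) v w hcard hvr (fun h => hwF (hFsub h)) hvw
    (H.mem_faces.2 ⟨_, hvK, fun h => ?_, fun h => ?_, himv⟩)
    (H.mem_faces.2 ⟨_, hwK, fun h => ?_, fun h => ?_, himw⟩)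
  rotate_left
  · rcases mem_insert.1 (h (hF ▸ mem_insert_self (ψ g) _)) with h | h
    · exact hv (h ▸ H.map_mem hgG)
    · exact hψg h
  · rcases mem_insert.1 (h hgG) with h | h
    · exact hvG (h ▸ hgG)
    · exact disjoint_left.1 H.disjoint (hFsub h) hgG
  · rcases mem_insert.1 (h (H.map_mem hgG)) with h | h
    · exact hwF (h ▸ H.map_mem hgG)
    · exact disjoint_left.1 H.disjoint (H.map_mem hgG) (hrsub h)
  · rcases mem_insert.1 (h hgG) with h | h
    · exact hw (h ▸ hgG)
    · exact hg h
  have e2 := hε₀ (r.image ψ) v (ψ g) hcard hvr hψg (fun e => hv (e ▸ H.map_mem hgG)) hvK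
    (hF ▸ H.left_facet.1)
  have e3 := hε₀ r w g hr hwr hg (fun e => hw (e ▸ hgG)) hwK (hrG ▸ H.right_facet.1)
  have hψG : Set.InjOn ψ (insert g r : Finset V) := by rw [hrG]; exact H.bijOn.injOn
  have i1 := inversionSign_insert hg hψG
  have i2 := inversionSign_insert hwr hiw
  have i3 := inversionSign_insert hvr hiv
  rw [H.image_left hFsub, hφv] at i3
  rw [hφr, hφw] at i2
  have i4 : inversionSign (r.image ψ) (identMap G ψ) = 1 := by
    rw [inversionSign, filter_false_of_mem, card_empty, pow_zero]
    rintro ⟨x, y⟩ hxy ⟨h1, h2⟩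
    rw [mem_product] at hxy
    simp only at h1 h2 hxy
    rw [H.identMap_left (hFsub hxy.1), H.identMap_left (hFsub hxy.2)] at h2
    exact h1.not_gt h2
  have i5 : inversionSign r (identMap G ψ) = inversionSign r ψ := by
    unfold inversionSign
    congr 2
    refine filter_congr ?_
    rintro ⟨x, y⟩ hxy
    rw [mem_product] at hxy
    rw [identMap, identMap, if_pos (hrsub hxy.1), if_pos (hrsub hxy.2)]
  rw [orientationSign, H.image_facet, ← hF, ← hrG] at hsign
  rw [i4, one_mul] at i3
  rw [i5] at i2
  unfold pullbackOrientation
  rw [himv, himw]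
  -- What remains is an identity between signs: each relation is solved for one sign, and squares
  -- cancel.
  generalize ε (insert v (r.image ψ)) = a at *
  generalize ε (insert w (r.image ψ)) = b at *
  generalize ε₀ (insert v (r.image ψ)) = a₀ at *
  generalize ε₀ (insert w r) = b₀ at *
  generalize ε₀ (insert (ψ g) (r.image ψ)) = f₀ at *
  generalize ε₀ (insert g r) = g₀ at *
  generalize inversionSign (insert g r) ψ = ig at *
  generalize inversionSign (insert w r) (identMap G ψ) = iw at *
  generalize inversionSign (insert v (r.image ψ)) (identMap G ψ) = iv at *
  generalize inversionSign r ψ = ir at *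
  generalize incidence (r.image ψ) v = cv at *
  generalize incidence (r.image ψ) w = cw at *
  generalize incidence (r.image ψ) (ψ g) = cψ at *
  generalize incidence r w = c' at *
  generalize incidence r g = cg at *
  clear * - e1 e2 e3 i1 i2 i3 hsign
  have key : ∀ {x y z : ℤˣ}, x * y = z → x = z * y := fun {x y z} h => by
    rw [← h, mul_assoc, Int.units_mul_self, mul_one]
  have h3 := key i3
  rw [Int.units_mul_self] at h3
  have h1 := key hsign
  rw [one_mul] at h1
  rw [h3, mul_one, key e1, key e2, key e3, key i2, ← h1, show cψ = ig * cg * ir by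
    rw [i1, mul_right_comm, Int.units_mul_self, one_mul]]
  simp only [neg_mul, mul_neg, neg_neg]
  have : b * cw * cv * (g₀ * ig * (ig * cg * ir) * cv) =
      (cv * cv) * (ig * ig) * (b * cw * g₀ * cg * ir) := by ac_rfl
  rw [this, Int.units_mul_self, Int.units_mul_self, one_mul, one_mul]
  have : b * (ir * cw * c') * (g₀ * cg * c') = (c' * c') * (b * cw * g₀ * cg * ir) := by ac_rfl
  rw [this, Int.units_mul_self, one_mul]

end Handle

end Orientation
end SphereBundles
namespace SphereBundles

open Finset

/-! ### The boundary orientation of the stacked ball -/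

section DeltaOrientation

variable {n i : ℕ}

lemma IsDeltaFace.mem_iff {j x : ℕ} {s : Finset ℕ} (h : IsDeltaFace n i j x s)
    (hs : s.card = n) (y : ℕ) : y ∈ s ↔ j ≤ y ∧ y ≤ j + n ∧ y ≠ x := by
  rw [h.eq_of_card hs, mem_erase, mem_Icc]; tauto

/-- If a facet lay in two windows, it would miss the left end of the earlier one, which is possible
only for the last window. -/
lemma IsDeltaFace.eq_of_eq (hn : 2 ≤ n) {j x j' x' : ℕ} {s : Finset ℕ}
    (h : IsDeltaFace n i j x s) (h' : IsDeltaFace n i j' x' s) (hs : s.card = n) :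
    j = j' ∧ x = x' := by
  have key : ∀ {j x j' x' : ℕ}, IsDeltaFace n i j x s → IsDeltaFace n i j' x' s → j' ≤ j := by
    intro j x j' x' h h'
    by_contra hlt
    have h1 := h.left; have h2 := h'.le
    have h3 := (h.mem_iff hs j).symm.trans (h'.mem_iff hs j)
    omega
  obtain rfl : j = j' := le_antisymm (key h' h) (key h h')
  refine ⟨rfl, ?_⟩
  have h3 := (h.mem_iff hs x).symm.trans (h'.mem_iff hs x)
  have := h.le_gap; have := h.gap_le
  omega

open Classical in
/-- The orientation of `Delta n i` as the boundary of a stacked ball. -/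
noncomputable def deltaOrientation (n i : ℕ) (s : Finset ℕ) : ℤˣ :=
  if h : ∃ p : ℕ × ℕ, IsDeltaFace n i p.1 p.2 s ∧ s.card = n then
    (-1) ^ (n * h.choose.1 + h.choose.2) else 1

/-- The sign is `(-1)^(x - j)`, the boundary sign of the facet missing `x` in the window of `j`,
times `(-1)^((n + 1) * j)`, which orients consecutive windows so that their common facet cancels. -/
lemma IsDeltaFace.deltaOrientation_eq (hn : 2 ≤ n) {j x : ℕ} {s : Finset ℕ}
    (h : IsDeltaFace n i j x s) (hs : s.card = n) :
    deltaOrientation n i s = (-1) ^ (n * j + x) := by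
  have hex : ∃ p : ℕ × ℕ, IsDeltaFace n i p.1 p.2 s ∧ s.card = n := ⟨(j, x), h, hs⟩
  rw [deltaOrientation, dif_pos hex]
  obtain ⟨h1, h2⟩ := hex.choose_spec.1.eq_of_eq hn h hs
  rw [h1, h2]

lemma IsDeltaFace.incidence_eq {j x v : ℕ} {r : Finset ℕ}
    (h : IsDeltaFace n i j x (insert v r)) (hr : r.card + 1 = n) (hv : v ∉ r) :
    incidence r v = (-1) ^ (v + j + if x < v then 1 else 0) := by
  have hc : (insert v r).card = n := by rw [card_insert_of_notMem hv, hr]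
  have h1 := (h.mem_iff hc v).1 (mem_insert_self _ _)
  have h2 := h.le_gap
  have hset : r.filter (fun y => y < v) = (Ico j v).erase x := by
    ext y
    have h3 := h.mem_iff hc y
    rw [mem_insert] at h3
    rw [mem_filter, mem_erase, mem_Ico]
    constructor
    · rintro ⟨h4, h5⟩
      have := h3.1 (Or.inr h4)
      omega
    · rintro ⟨h4, h5⟩
      refine ⟨(h3.2 (by omega)).resolve_left (by omega), by omega⟩
  have hpar : ∀ a b : ℕ, a % 2 = b % 2 → (-1 : ℤˣ) ^ a = (-1) ^ b := fun a b hab => by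
    rw [← Nat.div_add_mod a 2, ← Nat.div_add_mod b 2, hab, pow_add, pow_add, pow_mul, pow_mul]
    simp
  rw [incidence, hset]
  apply hpar
  split_ifs with hx
  · rw [card_erase_of_mem (mem_Ico.2 ⟨h2, hx⟩), Nat.card_Ico]; omega
  · rw [erase_eq_of_notMem (fun hm => hx (mem_Ico.1 hm).2), Nat.card_Ico]; omega

lemma deltaOrientation_coherent_of_le (hn : 2 ≤ n) {j x j' x' v w : ℕ} {r : Finset ℕ}
    (hr : r.card + 1 = n) (hv : v ∉ r) (hw : w ∉ r) (hvw : v ≠ w)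
    (h : IsDeltaFace n i j x (insert v r)) (h' : IsDeltaFace n i j' x' (insert w r))
    (hj : j ≤ j') :
    deltaOrientation n i (insert v r) * incidence r v =
      -(deltaOrientation n i (insert w r) * incidence r w) := by
  have hc : (insert v r).card = n := by rw [card_insert_of_notMem hv, hr]
  have hc' : (insert w r).card = n := by rw [card_insert_of_notMem hw, hr]
  rw [h.deltaOrientation_eq hn hc, h'.deltaOrientation_eq hn hc', h.incidence_eq hr hv,
    h'.incidence_eq hr hw, ← pow_add, ← pow_add]
  have hpar : ∀ a b : ℕ, Odd (a + b) → (-1 : ℤˣ) ^ a = -(-1) ^ b := fun a b hab => by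
    rcases Nat.even_or_odd a with ha | ha
    · rw [ha.neg_one_pow, ((Nat.odd_add'.1 hab).2 ha).neg_one_pow, neg_neg]
    · rw [ha.neg_one_pow, (Nat.odd_add.1 hab |>.1 ha).neg_one_pow]
  apply hpar
  -- Two descriptions of the ridge `r`; evaluating them at suitable `y` determines the parameters.
  have key : ∀ y, (j ≤ y ∧ y ≤ j + n ∧ y ≠ x ∧ y ≠ v) ↔ (j' ≤ y ∧ y ≤ j' + n ∧ y ≠ x' ∧ y ≠ w) := by
    intro y
    have h1 := h.mem_iff hc y
    have h2 := h'.mem_iff hc' y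
    rw [mem_insert] at h1 h2
    have h3 : y ∈ r → y ≠ v := fun a e => hv (e ▸ a)
    have h4 : y ∈ r → y ≠ w := fun a e => hw (e ▸ a)
    tauto
  have a1 := h.le_gap; have a2 := h.gap_le; have a3 := h.left; have a4 := h.right
  have b1 := h'.le_gap; have b2 := h'.gap_le; have b3 := h'.left; have b4 := h'.right
  have c1 := h.one_le; have c2 := h'.le
  have hv' := (h.mem_iff hc v).1 (mem_insert_self _ _)
  have hw' := (h'.mem_iff hc' w).1 (mem_insert_self _ _)
  clear hr hv hw h h' hc hc' hpar
  rcases hj.eq_or_lt with rfl | hj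
  · have k1 := key v
    have k2 := key w
    obtain rfl : x = w := by omega
    obtain rfl : x' = v := by omega
    rcases lt_or_gt_of_ne hvw with h | h
    · rw [if_neg h.not_gt, if_pos h]
      exact ⟨n * j + x + x' + j, by ring⟩
    · rw [if_pos h, if_neg h.not_gt]
      exact ⟨n * j + x + x' + j, by ring⟩
  -- For different windows the ridge lies in `{j', …, j + n}`, which must still have `n - 1`
  -- elements. So either `j' = j + 1` and the missing vertex is the same, or `j' = j + 2` and the
  -- ridge is the whole interval.
  · have k1 := key j
    obtain rfl : v = j := by omega
    have k2 := key (j' + n)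
    obtain rfl : w = j' + n := by omega
    rw [if_neg (by omega), if_pos (by omega)]
    have k3 := key (v + 1)
    have k4 := key (v + 2)
    have hj' : j' = v + 1 ∨ j' = v + 2 := by omega
    rcases hj' with rfl | rfl
    · have k5 := key x
      obtain rfl : x = x' := by omega
      exact ⟨n * v + n + x + 2 * v + 1, by ring⟩
    · have k5 := key (v + n + 1)
      obtain rfl : x' = v + n + 1 := by omega
      obtain rfl : x = v + 1 := by omega
      exact ⟨n * v + 3 * v + 2 * n + 3, by ring⟩

lemma isCoherentOrientation_delta (hi : 1 ≤ i) (hn : 2 ≤ n) :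
    IsCoherentOrientation n (Delta n i) (deltaOrientation n i) := by
  intro r v w hr hv hw hvw hvK hwK
  obtain ⟨-, j, x, h⟩ := (mem_delta_faces hi hn).1 hvK
  obtain ⟨-, j', x', h'⟩ := (mem_delta_faces hi hn).1 hwK
  rcases le_total j j' with hj | hj
  · exact deltaOrientation_coherent_of_le hn hr hv hw hvw h h' hj
  · rw [deltaOrientation_coherent_of_le hn hr hw hv hvw.symm h' h hj, neg_neg]

lemma isDeltaFace_firstFacet (hi : 1 ≤ i) (hn : 2 ≤ n) : IsDeltaFace n i 1 (n + 1) (firstFacet n) :=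
  ⟨le_rfl, hi, by omega, by omega, fun _ => by omega, fun _ => rfl, fun y hy => by
    have := mem_firstFacet.1 hy; omega⟩

lemma isDeltaFace_lastFacet (hn : 2 ≤ n) :
    IsDeltaFace n (2 * n + 2) (2 * n + 2) (2 * n + 2) (lastFacet n) :=
  ⟨by omega, le_rfl, le_rfl, by omega, fun _ => rfl, fun _ => by omega, fun y hy => by
    have := mem_lastFacet.1 hy; omega⟩

lemma card_lastFacet : (lastFacet n).card = n := by
  rw [lastFacet, Nat.card_Icc]; omega

/-- `F` misses `n + 1` in the first window and `G` misses `2n + 2` in the last. The exponents are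
odd and even for every `n`, so an order-preserving identification reverses orientations. -/
lemma orientationSign_delta (hn : 2 ≤ n) {ψ : ℕ → ℕ}
    (H : IsHandleIdentification (Delta n (2 * n + 2)) (firstFacet n) (lastFacet n) ψ) :
    orientationSign (deltaOrientation n (2 * n + 2)) (lastFacet n) ψ =
      -inversionSign (lastFacet n) ψ := by
  rw [orientationSign, H.image_facet,
    (isDeltaFace_firstFacet (by omega) hn).deltaOrientation_eq hn (by simp [firstFacet]),
    (isDeltaFace_lastFacet hn).deltaOrientation_eq hn card_lastFacet]
  have h1 : Even (n * (2 * n + 2) + (2 * n + 2)) := ⟨n * (n + 1) + (n + 1), by ring⟩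
  have h2 : Odd (n * 1 + (n + 1)) := ⟨n, by ring⟩
  rw [h1.neg_one_pow, h2.neg_one_pow]; simp

lemma inversionSign_straight : inversionSign (lastFacet n) (straightIdent n) = 1 := by
  rw [inversionSign, filter_false_of_mem, card_empty, pow_zero]
  rintro ⟨x, y⟩ - ⟨h1, h2⟩
  simp only [straightIdent] at h1 h2
  omega

lemma inversionSign_exchanged (hn : 2 ≤ n) :
    inversionSign (lastFacet n) (exchangedIdent n) = -1 := by
  have : ((lastFacet n ×ˢ lastFacet n).filter
      (fun p => p.1 < p.2 ∧ exchangedIdent n p.2 < exchangedIdent n p.1)) =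
      {(3 * n + 1, 3 * n + 2)} := by
    ext ⟨x, y⟩
    rw [mem_filter, mem_product, mem_lastFacet, mem_lastFacet, mem_singleton, Prod.mk.injEq]
    simp only [exchangedIdent, Equiv.swap_apply_def, straightIdent]
    split_ifs <;> omega
  rw [inversionSign, this, card_singleton, pow_one]

end DeltaOrientation

/-! ### Nonorientability of the exchanged handle addition -/

section NonOrientable

variable {n : ℕ} {ψ : ℕ → ℕ}

lemma isDeltaFace_inner {j x : ℕ} (h1 : 1 ≤ j) (h2 : j ≤ 2 * n + 2) (h3 : j < x)
    (h4 : x < j + n) : IsDeltaFace n (2 * n + 2) j x ((Icc j (j + n)).erase x) :=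
  ⟨h1, h2, h3.le, h4.le, fun _ => by omega, fun _ => by omega, fun y hy => by
    rw [mem_erase, mem_Icc] at hy; omega⟩

lemma inner_mem_faces (hn : 2 ≤ n) {j x : ℕ} (h1 : 1 ≤ j) (h2 : j ≤ 2 * n + 2) (h3 : j < x)
    (h4 : x < j + n) : (Icc j (j + n)).erase x ∈ (Delta n (2 * n + 2)).faces :=
  (mem_delta_faces (by omega) hn).2 ⟨⟨j, mem_erase.2 ⟨h3.ne, mem_Icc.2 (by omega)⟩⟩, j, x,
    isDeltaFace_inner h1 h2 h3 h4⟩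

lemma not_firstFacet_subset {j x : ℕ} (hj : 1 ≤ j) (h3 : j < x) (h4 : x < j + n) :
    ¬ firstFacet n ⊆ (Icc j (j + n)).erase x := by
  intro h
  have h5 := h (mem_firstFacet.2 (by omega) : 1 ∈ firstFacet n)
  rw [mem_erase, mem_Icc] at h5
  have h6 := h (mem_firstFacet.2 (by omega) : x ∈ firstFacet n)
  exact notMem_erase _ _ h6

lemma not_lastFacet_subset {j x : ℕ} (hj : j ≤ 2 * n + 2) (h3 : j < x) (h4 : x < j + n) :
    ¬ lastFacet n ⊆ (Icc j (j + n)).erase x := by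
  intro h
  have h5 := h (mem_lastFacet.2 (by omega) : 3 * n + 2 ∈ lastFacet n)
  rw [mem_erase, mem_Icc] at h5
  have h6 := h (mem_lastFacet.2 (by omega) : x ∈ lastFacet n)
  exact notMem_erase _ _ h6

/-- The ratio of a pulled back orientation and the standard one. -/
noncomputable def orientationRatio (n : ℕ) (ψ : ℕ → ℕ) (ε : Finset ℕ → ℤˣ) (s : Finset ℕ) : ℤˣ :=
  pullbackOrientation ε (identMap (lastFacet n) ψ) s * deltaOrientation n (2 * n + 2) s

/-- Both orientations are coherent across the common ridge, so their ratio does not change there. -/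
lemma orientationRatio_eq
    (H : IsHandleIdentification (Delta n (2 * n + 2)) (firstFacet n) (lastFacet n) ψ)
    (hn : 2 ≤ n) {ε : Finset ℕ → ℤˣ}
    (hε : IsCoherentOrientation n
      (handleAddition (Delta n (2 * n + 2)) (firstFacet n) (lastFacet n) ψ) ε)
    {j x j' x' v w : ℕ} {r : Finset ℕ} (hr : r.card + 1 = n) (hv : v ∉ r) (hw : w ∉ r)
    (hvw : v ≠ w) (hvr : insert v r = (Icc j (j + n)).erase x)
    (hwr : insert w r = (Icc j' (j' + n)).erase x')
    (h1 : 1 ≤ j) (h2 : j ≤ 2 * n + 2) (h3 : j < x) (h4 : x < j + n)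
    (h1' : 1 ≤ j') (h2' : j' ≤ 2 * n + 2) (h3' : j' < x') (h4' : x' < j' + n) :
    orientationRatio n ψ ε ((Icc j (j + n)).erase x) =
      orientationRatio n ψ ε ((Icc j' (j' + n)).erase x') := by
  have hvK := inner_mem_faces hn h1 h2 h3 h4
  have hwK := inner_mem_faces hn h1' h2' h3' h4'
  have e1 := H.pullback_coherent hn hε hr hv hw hvw (hvr ▸ hvK) (hwr ▸ hwK)
    (hvr ▸ not_firstFacet_subset h1 h3 h4) (hvr ▸ not_lastFacet_subset h2 h3 h4)
    (hwr ▸ not_firstFacet_subset h1' h3' h4') (hwr ▸ not_lastFacet_subset h2' h3' h4')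
  have e2 := isCoherentOrientation_delta (i := 2 * n + 2) (by omega) hn r v w hr hv hw hvw
    (hvr ▸ hvK) (hwr ▸ hwK)
  rw [orientationRatio, orientationRatio, ← hvr, ← hwr]
  have : ∀ a b c d e f : ℤˣ, a * e = -(b * f) → c * e = -(d * f) → a * c = b * d := by
    intro a b c d e f h h'
    have h5 : (a * e) * (c * e) = (b * f) * (d * f) := by rw [h, h', neg_mul_neg]
    rwa [mul_mul_mul_comm, mul_mul_mul_comm b, Int.units_mul_self, Int.units_mul_self, mul_one,
      mul_one] at h5
  exact this _ _ _ _ _ _ e1 e2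

/-- The facets other than `F` and `G` are connected through ridges: any two in one window are
adjacent, and the windows of `j` and `j + 1` are linked by their facets missing `j + 2`. The link
needs `j + 2 < j + n`, hence `n ≥ 3`. -/
lemma orientationRatio_const
    (H : IsHandleIdentification (Delta n (2 * n + 2)) (firstFacet n) (lastFacet n) ψ)
    (hn : 3 ≤ n) {ε : Finset ℕ → ℤˣ}
    (hε : IsCoherentOrientation n
      (handleAddition (Delta n (2 * n + 2)) (firstFacet n) (lastFacet n) ψ) ε)
    {j x : ℕ} (h1 : 1 ≤ j) (h2 : j ≤ 2 * n + 2) (h3 : j < x) (h4 : x < j + n) :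
    orientationRatio n ψ ε ((Icc j (j + n)).erase x) =
      orientationRatio n ψ ε ((Icc 1 (1 + n)).erase 2) := by
  have step : ∀ j x x', 1 ≤ j → j ≤ 2 * n + 2 → j < x → x < j + n → j < x' → x' < j + n →
      orientationRatio n ψ ε ((Icc j (j + n)).erase x) =
      orientationRatio n ψ ε ((Icc j (j + n)).erase x') := by
    intro j x x' h1 h2 h3 h4 h3' h4'
    by_cases hx : x = x'
    · rw [hx]
    refine orientationRatio_eq H (by omega) hε (r := ((Icc j (j + n)).erase x).erase x')
      (v := x') (w := x) ?_ (notMem_erase _ _) ?_ (Ne.symm hx) ?_ ?_ h1 h2 h3 h4 h1 h2 h3' h4'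
    · rw [card_erase_of_mem (mem_erase.2 ⟨Ne.symm hx, mem_Icc.2 (by omega)⟩),
        card_Icc_erase (by omega) (by omega)]; omega
    · simp
    · exact insert_erase (mem_erase.2 ⟨Ne.symm hx, mem_Icc.2 (by omega)⟩)
    · rw [erase_right_comm]
      exact insert_erase (mem_erase.2 ⟨hx, mem_Icc.2 (by omega)⟩)
  induction j, h1 using Nat.le_induction generalizing x with
  | base => exact step 1 x 2 le_rfl (by omega) h3 h4 (by omega) (by omega)
  | succ j hj ih =>
    rw [step (j + 1) x (j + 2) (by omega) h2 h3 h4 (by omega) (by omega),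
      ← ih (x := j + 2) (by omega) (by omega) (by omega)]
    refine orientationRatio_eq H (by omega) hε (r := (Icc (j + 1) (j + n)).erase (j + 2))
      (v := j + 1 + n) (w := j) ?_ ?_ ?_ (by omega) ?_ ?_ (by omega) h2 (by omega) (by omega) hj
      (by omega) (by omega) (by omega)
    · rw [card_erase_of_mem (mem_Icc.2 (by omega)), Nat.card_Icc]; omega
    · rw [mem_erase, mem_Icc]; omega
    · rw [mem_erase, mem_Icc]; omega
    · ext y; simp only [mem_insert, mem_erase, mem_Icc]; omega
    · ext y; simp only [mem_insert, mem_erase, mem_Icc]; omega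

/-- The handle is crossed at the ridge `{2n + 4, …, 3n + 2}` of `G`, identified with `{2, …, n}`;
the condition on `ψ (2n + 3)` ensures this. The neighbours of `F` and `G` there arise by adding `n +
2` and `2n + 2`, and both carry the constant ratio. -/
lemma not_isOrientable_handleAddition
    (H : IsHandleIdentification (Delta n (2 * n + 2)) (firstFacet n) (lastFacet n) ψ)
    (hn : 3 ≤ n) (hψ : ψ (2 * n + 3) = 1)
    (hsign : orientationSign (deltaOrientation n (2 * n + 2)) (lastFacet n) ψ = 1) :
    ¬ IsOrientable n (handleAddition (Delta n (2 * n + 2)) (firstFacet n) (lastFacet n) ψ) := by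
  rintro ⟨ε, hε⟩
  have hgG : 2 * n + 3 ∈ lastFacet n := mem_lastFacet.2 (by omega)
  have him : ((lastFacet n).erase (2 * n + 3)).image ψ = Icc 2 n := by
    have hF := H.image_facet
    ext y
    rw [mem_image, mem_Icc]
    constructor
    · rintro ⟨x, hx, rfl⟩
      have hx' := mem_erase.1 hx
      have h1 := mem_firstFacet.1 (H.map_mem hx'.2)
      have : ψ x ≠ 1 := fun e => hx'.1 (H.bijOn.injOn hx'.2 hgG (e.trans hψ.symm))
      omega
    · intro hy
      have : y ∈ firstFacet n := mem_firstFacet.2 (by omega)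
      rw [← hF, mem_image] at this
      obtain ⟨x, hx, rfl⟩ := this
      refine ⟨x, mem_erase.2 ⟨fun e => ?_, hx⟩, rfl⟩
      rw [e, hψ] at hy
      omega
  have ev : insert (n + 2) (Icc 2 n) = (Icc 2 (2 + n)).erase (n + 1) := by
    ext y; simp only [mem_insert, mem_erase, mem_Icc]; omega
  have ew : insert (2 * n + 2) ((lastFacet n).erase (2 * n + 3)) =
      (Icc (2 * n + 2) (2 * n + 2 + n)).erase (2 * n + 3) := by
    ext y; simp only [mem_insert, mem_erase, mem_Icc, mem_lastFacet]; omega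
  have key := H.ratio_eq_neg (by omega) hε (isCoherentOrientation_delta (by omega) (by omega)) hsign
    card_lastFacet (r := (lastFacet n).erase (2 * n + 3)) (g := 2 * n + 3) (v := n + 2)
    (w := 2 * n + 2) (notMem_erase _ _) (insert_erase hgG)
    (by rw [mem_firstFacet]; omega) (by rw [mem_lastFacet]; omega)
    (by rw [mem_lastFacet]; omega) (by rw [mem_firstFacet]; omega) (by omega)
    (by rw [him, ev]; exact inner_mem_faces (by omega) (by omega) (by omega) (by omega) (by omega))
    (by rw [ew]; exact inner_mem_faces (by omega) (by omega) le_rfl (by omega) (by omega))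
  rw [him, ev, ew] at key
  change orientationRatio n ψ ε _ = -(orientationRatio n ψ ε _) at key
  rw [orientationRatio_const H hn hε (by omega) (by omega) (by omega) (by omega),
    orientationRatio_const H hn hε (by omega) le_rfl (by omega) (by omega)] at key
  exact units_ne_neg_self _ key

end NonOrientable
end SphereBundles
namespace SphereBundles

open Set Topology unitInterval

/-! ### Quotients of a cylinder by a gluing of its ends -/

section Gluing

variable {S Z Z' : Type*} [TopologicalSpace S] [TopologicalSpace Z] [TopologicalSpace Z']

/-- `q` presents `Z` as the quotient of `S × [0, 1]` by the gluing `(x, 0) ∼ (ρ x, 1)`. -/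
structure IsGluing (ρ : S → S) (q : S × I → Z) : Prop where
  isQuotientMap : IsQuotientMap q
  eq_iff : ∀ a b, q a = q b ↔
    a = b ∨ (a.2 = 0 ∧ b.2 = 1 ∧ b.1 = ρ a.1) ∨ (b.2 = 0 ∧ a.2 = 1 ∧ a.1 = ρ b.1)

lemma IsGluing.of_continuous [CompactSpace S] [T2Space Z] {ρ : S → S} {q : S × I → Z}
    (hq : Continuous q) (hs : Function.Surjective q)
    (h : ∀ a b, q a = q b ↔
      a = b ∨ (a.2 = 0 ∧ b.2 = 1 ∧ b.1 = ρ a.1) ∨ (b.2 = 0 ∧ a.2 = 1 ∧ a.1 = ρ b.1)) :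
    IsGluing ρ q :=
  ⟨hq.isClosedMap.isQuotientMap hq hs, h⟩

lemma IsGluing.nonempty_homeomorph {ρ : S → S} {q : S × I → Z} {q' : S × I → Z'}
    (h : IsGluing ρ q) (h' : IsGluing ρ q') : Nonempty (Z ≃ₜ Z') := by
  have e1 := IsQuotientMap.homeomorph (f := ⟨q, h.isQuotientMap.continuous⟩) h.isQuotientMap
  have e2 := IsQuotientMap.homeomorph (f := ⟨q', h'.isQuotientMap.continuous⟩) h'.isQuotientMap
  have hker : Setoid.ker q = Setoid.ker q' := by
    ext a b
    rw [Setoid.ker_def, Setoid.ker_def, h.eq_iff, h'.eq_iff]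
  change Quotient (Setoid.ker q) ≃ₜ Z at e1
  change Quotient (Setoid.ker q') ≃ₜ Z' at e2
  rw [hker] at e1
  exact ⟨e1.symm.trans e2⟩

/-- The generated equivalence relation adds only equality and converses: the two ends of the
interval are distinct, and `ρ` is an involution, so composing a gluing with a converse one gives an
equality. -/
lemma isGluing_twistRel (m : ℕ) {ρ : Sphere m → Sphere m}
    (hρ : ∀ x y : Sphere m,
      y = ρ x ↔ y.1 0 = - x.1 0 ∧ ∀ j : Fin (m + 1), j ≠ 0 → y.1 j = x.1 j) :
    IsGluing ρ (Quot.mk (TwistRel m)) := by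
  refine ⟨isQuotientMap_quot_mk, fun a b => ?_⟩
  have hrel : ∀ a b, TwistRel m a b ↔ a.2 = 0 ∧ b.2 = 1 ∧ b.1 = ρ a.1 := fun a b => by
    rw [hρ]; rfl
  rw [← hrel, ← hrel]
  constructor
  · intro h
    have h' := Quot.eqvGen_exact h
    clear h
    induction h' with
    | rel a b h => exact Or.inr (Or.inl h)
    | refl a => exact Or.inl rfl
    | symm a b h ih =>
      rcases ih with h | h | h
      · exact Or.inl h.symm
      · exact Or.inr (Or.inr h)
      · exact Or.inr (Or.inl h)
    | trans a b c h1 h2 ih1 ih2 =>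
      have inv : ∀ x y, y = ρ x → x = ρ y := fun x y h => by
        rw [hρ] at h ⊢
        exact ⟨by rw [h.1, neg_neg], fun j hj => (h.2 j hj).symm⟩
      have h01 : (0 : I) ≠ 1 := zero_ne_one
      rcases ih1 with rfl | h1 | h1 <;>
        rcases ih2 with rfl | h2 | h2
      · exact Or.inl rfl
      · exact Or.inr (Or.inl h2)
      · exact Or.inr (Or.inr h2)
      · exact Or.inr (Or.inl h1)
      · exact (h01 (h2.1.symm.trans h1.2.1)).elim
      · left
        rw [hrel] at h1 h2
        refine Prod.ext ?_ (h1.1.trans h2.1.symm)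
        rw [inv _ _ h1.2.2, inv _ _ h2.2.2]
      · exact Or.inr (Or.inr h1)
      · left
        rw [hrel] at h1 h2
        refine Prod.ext ?_ (h1.2.1.trans h2.2.1.symm)
        rw [h1.2.2, h2.2.2]
      · exact (h01 (h1.1.symm.trans h2.2.1)).elim
  · rintro (rfl | h | h)
    · rfl
    · exact Quot.sound h
    · exact (Quot.sound h).symm

/-- The loop `t ↦ exp (2 π i t)`. -/
noncomputable def circleLoop (t : ℝ) : Circle := Circle.exp (2 * Real.pi * t)

lemma continuous_circleLoop : Continuous circleLoop :=
  Circle.exp.continuous.comp (continuous_const.mul continuous_id)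

lemma circleLoop_add (s t : ℝ) : circleLoop (s + t) = circleLoop s * circleLoop t := by
  rw [circleLoop, mul_add, Circle.exp_add]; rfl

lemma circleLoop_zero : circleLoop 0 = 1 := by simp [circleLoop]

lemma circleLoop_one : circleLoop 1 = 1 := by simp [circleLoop]

lemma circleLoop_eq_iff {s t : ℝ} : circleLoop s = circleLoop t ↔ ∃ m : ℤ, s = t + m := by
  rw [circleLoop, circleLoop, Circle.exp_eq_exp]
  refine exists_congr fun m => ?_
  have : 2 * Real.pi ≠ 0 := by positivity
  rw [show 2 * Real.pi * t + m * (2 * Real.pi) = 2 * Real.pi * (t + m) by ring,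
    mul_right_inj' this]

lemma circleLoop_eq_iff_of_mem {s t : I} :
    circleLoop s = circleLoop t ↔ s = t ∨ (s = 0 ∧ t = 1) ∨ (t = 0 ∧ s = 1) := by
  constructor
  · intro h
    obtain ⟨m, hm⟩ := circleLoop_eq_iff.1 h
    have h1 := s.2.1; have h2 := s.2.2; have h3 := t.2.1; have h4 := t.2.2
    have h5 : (-2 : ℝ) < m := by linarith
    have h6 : (m : ℝ) < 2 := by linarith
    have h5' : -2 < m := by exact_mod_cast h5
    have h6' : m < 2 := by exact_mod_cast h6
    obtain rfl | rfl | rfl : m = -1 ∨ m = 0 ∨ m = 1 := by omega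
    · right; left
      push_cast at hm
      exact ⟨Subtype.ext (show (s : ℝ) = 0 by linarith), Subtype.ext (show (t : ℝ) = 1 by linarith)⟩
    · left; exact Subtype.ext (by simpa using hm)
    · right; right
      push_cast at hm
      exact ⟨Subtype.ext (show (t : ℝ) = 0 by linarith), Subtype.ext (show (s : ℝ) = 1 by linarith)⟩
  · rintro (rfl | ⟨rfl, rfl⟩ | ⟨rfl, rfl⟩) <;> simp [circleLoop_zero, circleLoop_one]

lemma exists_circleLoop (z : Circle) : ∃ t : I, circleLoop t = z := by
  have hz : Circle.exp (Complex.arg z) = z := Circle.exp_arg z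
  refine ⟨⟨Int.fract (Complex.arg z / (2 * Real.pi)), Int.fract_nonneg _,
    (Int.fract_lt_one _).le⟩, ?_⟩
  have hz' : circleLoop (Complex.arg z / (2 * Real.pi)) = z := by
    rw [circleLoop, mul_div_cancel₀ _ (by positivity), hz]
  refine Eq.trans (circleLoop_eq_iff.2 ⟨-⌊Complex.arg z / (2 * Real.pi)⌋, ?_⟩) hz'
  simp [Int.fract, sub_eq_add_neg]

/-- The product as a model gluing. It identifies gluings by the identity and, cut open over `b`, is
the target of the local trivializations. -/
lemma isGluing_circle [CompactSpace S] [T2Space S] (b : Circle) :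
    IsGluing (id : S → S) fun a : S × I => (b * circleLoop a.2, a.1) := by
  refine .of_continuous ?_ ?_ ?_
  · exact (continuous_const.mul (continuous_circleLoop.comp
      (continuous_subtype_val.comp continuous_snd))).prodMk continuous_fst
  · rintro ⟨z, x⟩
    obtain ⟨t, ht⟩ := exists_circleLoop (b⁻¹ * z)
    exact ⟨(x, t), by simp [ht]⟩
  · rintro ⟨x, s⟩ ⟨y, t⟩
    simp only [Prod.mk.injEq, mul_right_inj, circleLoop_eq_iff_of_mem, id]
    have e : y = x ↔ x = y := eq_comm
    rw [e]
    tauto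

lemma IsGluing.circle_homeomorph [CompactSpace S] [T2Space S] {q : S × I → Z}
    (h : IsGluing id q) : Nonempty (Z ≃ₜ S × Circle) := by
  obtain ⟨e⟩ := h.nonempty_homeomorph (isGluing_circle (S := S) 1)
  exact ⟨e.trans (Homeomorph.prodComm _ _)⟩

/-- Change of the gluing map by a path `h` of surjections that starts at the identity. -/
lemma IsGluing.isotopy [CompactSpace S] [T2Space Z] {ρ ρ' : S → S} {q : S × I → Z}
    (hq : IsGluing ρ q) {h : I → S → S} (hc : Continuous fun p : S × I => h p.2 p.1)
    (h0 : ∀ x, h 0 x = x) (hb : ∀ t, Function.Bijective (h t)) (h1 : ∀ x, h 1 (ρ' x) = ρ x) :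
    IsGluing ρ' fun p => q (h p.2 p.1, p.2) := by
  refine .of_continuous ?_ ?_ ?_
  · exact hq.isQuotientMap.continuous.comp (hc.prodMk continuous_snd)
  · intro z
    obtain ⟨⟨y, t⟩, rfl⟩ := hq.isQuotientMap.surjective z
    obtain ⟨x, rfl⟩ := (hb t).2 y
    exact ⟨(x, t), rfl⟩
  · rintro ⟨x, s⟩ ⟨y, t⟩
    rw [hq.eq_iff]
    simp only [Prod.mk.injEq]
    refine or_congr ⟨?_, ?_⟩ (or_congr ⟨?_, ?_⟩ ⟨?_, ?_⟩)
    · rintro ⟨h2, rfl⟩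
      exact ⟨(hb s).1 h2, rfl⟩
    · rintro ⟨rfl, rfl⟩
      exact ⟨rfl, rfl⟩
    · rintro ⟨rfl, rfl, h2⟩
      rw [h0, ← h1] at h2
      exact ⟨rfl, rfl, (hb 1).1 h2⟩
    · rintro ⟨rfl, rfl, rfl⟩
      exact ⟨rfl, rfl, by rw [h0, h1]⟩
    · rintro ⟨rfl, rfl, h2⟩
      rw [h0, ← h1] at h2
      exact ⟨rfl, rfl, (hb 1).1 h2⟩
    · rintro ⟨rfl, rfl, rfl⟩
      exact ⟨rfl, rfl, by rw [h0, h1]⟩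

end Gluing

/-! ### Local triviality over the circle -/

section Bundle

variable {S Z : Type*} [TopologicalSpace S] [TopologicalSpace Z]

/-- The open cylinder in a gluing. -/
def openCylinder (S : Type*) : Set (S × I) := {a | a.2 ≠ 0 ∧ a.2 ≠ 1}

lemma isOpen_openCylinder : IsOpen (openCylinder S) :=
  (isOpen_ne_fun continuous_snd continuous_const).inter
    (isOpen_ne_fun continuous_snd continuous_const)

lemma IsGluing.isOpenEmbedding {ρ : S → S} {q : S × I → Z} (h : IsGluing ρ q) :
    IsOpenEmbedding ((openCylinder S).domRestrict q) := by
  refine .of_continuous_injective_isOpenMap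
    (h.isQuotientMap.continuous.comp continuous_subtype_val) ?_ ?_
  · rintro ⟨a, ha⟩ ⟨b, hb⟩ hab
    rcases (h.eq_iff a b).1 hab with h | h | h
    · exact Subtype.ext h
    · exact (ha.1 h.1).elim
    · exact (hb.1 h.1).elim
  · intro U hU
    rw [← h.isQuotientMap.isOpen_preimage]
    obtain ⟨V, hV, rfl⟩ := hU
    convert! hV.inter (isOpen_openCylinder (S := S)) using 1
    ext a
    constructor
    · rintro ⟨⟨b, hb⟩, hbV, hba⟩
      rcases (h.eq_iff b a).1 hba with rfl | h | h
      · exact ⟨hbV, hb⟩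
      · exact (hb.1 h.1).elim
      · exact (hb.2 h.2.1).elim
    · rintro ⟨h1, h2⟩
      exact ⟨⟨a, h2⟩, h1, rfl⟩

lemma IsGluing.range_restrict {ρ : S → S} {q : S × I → Z} (h : IsGluing ρ q) {p : Z → Circle}
    {b : Circle} (hp : ∀ a, p (q a) = b * circleLoop a.2) :
    range ((openCylinder S).domRestrict q) = p ⁻¹' {b}ᶜ := by
  have key : ∀ a : S × I, p (q a) ≠ b ↔ a ∈ openCylinder S := by
    intro a
    rw [hp, Ne, mul_eq_left, ← circleLoop_zero, ← Set.Icc.coe_zero, circleLoop_eq_iff_of_mem]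
    have : (0 : I) ≠ 1 := zero_ne_one
    simp only [openCylinder, mem_ofPred_eq]
    have e : (0 : I) = 1 ↔ False := by simp
    tauto
  ext z
  obtain ⟨a, rfl⟩ := h.isQuotientMap.surjective z
  rw [mem_preimage, mem_compl_singleton_iff, key]
  constructor
  · rintro ⟨⟨b, hb⟩, hba⟩
    rw [← key] at hb ⊢
    rwa [← hba]
  · exact fun ha => ⟨⟨a, ha⟩, rfl⟩

/-- Away from `b` the gluing and the product are both open embeddings of the same open cylinder; the
trivialization compares the two. -/
lemma IsGluing.exists_trivialization [CompactSpace S] [T2Space S] [Nonempty S] {ρ : S → S}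
    {q : S × I → Z} (h : IsGluing ρ q) {p : Z → Circle} {b : Circle}
    (hp : ∀ a, p (q a) = b * circleLoop a.2) :
    ∃ e : Bundle.Trivialization S p, e.baseSet = {b}ᶜ := by
  have hk := isGluing_circle (S := S) b
  have : Nonempty (openCylinder S) := ⟨⟨(Classical.arbitrary S, ⟨1 / 2, by norm_num, by norm_num⟩),
    fun h => by simpa using congrArg Subtype.val h, fun h => by
      have := congrArg Subtype.val h
      norm_num at this⟩⟩
  let e₁ := h.isOpenEmbedding.toOpenPartialHomeomorph
  let e₂ := hk.isOpenEmbedding.toOpenPartialHomeomorph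
  have hs : (e₁.symm.trans e₂).source = p ⁻¹' {b}ᶜ := by
    rw [← h.range_restrict hp]; simp [e₁, e₂]
  have ht : (e₁.symm.trans e₂).target = ({b}ᶜ : Set Circle) ×ˢ univ := by
    rw [prod_univ, ← hk.range_restrict (p := Prod.fst) fun _ => rfl]; simp [e₁, e₂]
  refine ⟨⟨e₁.symm.trans e₂, {b}ᶜ, isOpen_compl_singleton, hs, ht, ?_⟩, rfl⟩
  intro z hz
  rw [hs, ← h.range_restrict hp] at hz
  obtain ⟨a, rfl⟩ := hz
  have : e₁.symm ((openCylinder S).domRestrict q a) = a := e₁.left_inv (by simp [e₁])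
  change (e₂ (e₁.symm _)).1 = _
  rw [this]
  exact (hp a).symm

/-- The gluing cut open at the parameter `1 / 2`. -/
lemma IsGluing.shift [CompactSpace S] [T2Space Z] {ρ : S ≃ₜ S} {q : S × I → Z}
    (h : IsGluing ρ q) {p : Z → Circle} (hp : ∀ a, p (q a) = circleLoop a.2) :
    ∃ q' : S × I → Z, IsGluing ρ q' ∧ ∀ a, p (q' a) = circleLoop (1 / 2) * circleLoop a.2 := by
  -- The second half of the old cylinder comes first, then the first half, entered through `ρ⁻¹`
  -- because `q (ρ⁻¹ x, 0) = q (x, 1)` at the seam. The projection only makes the formulas total.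
  let f₁ : S × I → S × I := fun a => (a.1, projIcc 0 1 zero_le_one (a.2 + 1 / 2))
  let f₂ : S × I → S × I := fun a => (ρ.symm a.1, projIcc 0 1 zero_le_one (a.2 - 1 / 2))
  have hf₁ : Continuous f₁ := by fun_prop
  have hf₂ : Continuous f₂ := by fun_prop
  let q' : S × I → Z := fun a => if (a.2 : ℝ) ≤ 1 / 2 then q (f₁ a) else q (f₂ a)
  have hglue : ∀ x, q (x, 0) = q (ρ x, 1) := fun x =>
    (h.eq_iff _ _).2 (Or.inr (Or.inl ⟨rfl, rfl, rfl⟩))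
  have v₁ : ∀ a : S × I, (a.2 : ℝ) ≤ 1 / 2 → ((f₁ a).2 : ℝ) = a.2 + 1 / 2 := fun a ha => by
    have := a.2.2.1
    rw [show (f₁ a).2 = projIcc 0 1 zero_le_one ((a.2 : ℝ) + 1 / 2) from rfl,
      projIcc_of_mem _ ⟨by linarith, by linarith⟩]
  have v₂ : ∀ a : S × I, 1 / 2 ≤ (a.2 : ℝ) → ((f₂ a).2 : ℝ) = a.2 - 1 / 2 := fun a ha => by
    have := a.2.2.2
    rw [show (f₂ a).2 = projIcc 0 1 zero_le_one ((a.2 : ℝ) - 1 / 2) from rfl,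
      projIcc_of_mem _ ⟨by linarith, by linarith⟩]
  have hcont : Continuous q' := by
    refine Continuous.if_le (h.isQuotientMap.continuous.comp hf₁)
      (h.isQuotientMap.continuous.comp hf₂) (by fun_prop) continuous_const fun a ha => ?_
    have e1 : f₁ a = (ρ (f₂ a).1, 1) :=
      Prod.ext (by simp [f₁, f₂]) (Subtype.ext (by rw [v₁ a ha.le, ha]; norm_num))
    have e2 : f₂ a = ((f₂ a).1, 0) :=
      Prod.ext rfl (Subtype.ext (by rw [v₂ a ha.ge, ha]; norm_num))
    change q (f₁ a) = q (f₂ a)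
    rw [e1, e2, hglue]
  refine ⟨q', .of_continuous hcont ?_ ?_, ?_⟩
  · intro z
    obtain ⟨⟨x, t⟩, rfl⟩ := h.isQuotientMap.surjective z
    have ht0 := t.2.1
    have ht1 := t.2.2
    rcases le_or_gt (1 / 2 : ℝ) t with ht | ht
    · have hm : (t : ℝ) - 1 / 2 ∈ I := ⟨by linarith, by linarith⟩
      refine ⟨(x, ⟨t - 1 / 2, hm⟩), ?_⟩
      have hle : (t : ℝ) - 1 / 2 ≤ 1 / 2 := by linarith
      simp only [q', if_pos hle]
      congr 1
      refine Prod.ext rfl (Subtype.ext ?_)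
      rw [v₁ _ hle]; simp
    · have hm : (t : ℝ) + 1 / 2 ∈ I := ⟨by linarith, by linarith⟩
      -- At `t = 0` the new parameter is `1 / 2`, where the first formula applies, so the point is
      -- rewritten at the other end of the old cylinder.
      by_cases h0 : t = 0
      · refine ⟨(ρ x, ⟨t + 1 / 2, hm⟩), ?_⟩
        have hle : (t : ℝ) + 1 / 2 ≤ 1 / 2 := by simp [h0]
        simp only [q', if_pos hle]
        rw [show (x, t) = (x, 0) by rw [h0], hglue]
        congr 1
        refine Prod.ext rfl (Subtype.ext ?_)
        rw [v₁ _ hle]; simp [h0]; norm_num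
      have hpos : (0 : ℝ) < t := lt_of_le_of_ne ht0 fun e => h0 (Subtype.ext e.symm)
      refine ⟨(ρ x, ⟨t + 1 / 2, hm⟩), ?_⟩
      have hle : ¬ (t : ℝ) + 1 / 2 ≤ 1 / 2 := by linarith
      simp only [q', if_neg hle]
      congr 1
      refine Prod.ext (by simp [f₂]) (Subtype.ext ?_)
      rw [v₂ _ (le_of_not_ge hle)]; simp
  · have ne0 : ∀ {a : S × I}, (a.2 : ℝ) ≤ 1 / 2 → (f₁ a).2 ≠ 0 := fun {a} ha e => by
      have h1 := v₁ a ha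
      rw [e] at h1
      have := a.2.2.1
      simp at h1; linarith
    have ne1 : ∀ {a : S × I}, 1 / 2 < (a.2 : ℝ) → (f₂ a).2 ≠ 0 := fun {a} ha e => by
      have h1 := v₂ a ha.le
      rw [e] at h1
      simp at h1; linarith
    have mixed : ∀ a b : S × I, (a.2 : ℝ) ≤ 1 / 2 → 1 / 2 < (b.2 : ℝ) →
        (q (f₁ a) = q (f₂ b) ↔ a.2 = 0 ∧ b.2 = 1 ∧ b.1 = ρ a.1) := by
      intro a b ha hb
      have h1 := v₁ a ha
      have h2 := v₂ b hb.le
      have h3 := a.2.2.1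
      have h4 := b.2.2.2
      rw [h.eq_iff]
      constructor
      · rintro (e | e | e)
        · have e1 : ((f₁ a).2 : ℝ) = (f₂ b).2 := by rw [e]
          have e2 : (f₁ a).1 = (f₂ b).1 := by rw [e]
          refine ⟨Subtype.ext (show (a.2 : ℝ) = 0 by linarith),
            Subtype.ext (show (b.2 : ℝ) = 1 by linarith), ?_⟩
          simp only [f₁, f₂] at e2
          rw [e2]; simp
        · exact (ne0 ha e.1).elim
        · exact (ne1 hb e.1).elim
      · rintro ⟨e1, e2, e3⟩
        left
        refine Prod.ext ?_ (Subtype.ext ?_)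
        · simp [f₁, f₂, e3]
        · rw [h1, h2, e1, e2]; norm_num
    intro a b
    have h01 : (0 : I) ≠ 1 := zero_ne_one
    rcases le_or_gt (a.2 : ℝ) (1 / 2) with ha | ha <;> rcases le_or_gt (b.2 : ℝ) (1 / 2) with hb | hb
    · simp only [q', if_pos ha, if_pos hb]
      rw [h.eq_iff]
      have h1 := v₁ a ha
      have h2 := v₁ b hb
      constructor
      · rintro (e | e | e)
        · left
          have e1 : ((f₁ a).2 : ℝ) = (f₁ b).2 := by rw [e]
          exact Prod.ext (congrArg Prod.fst e :) (Subtype.ext (by linarith))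
        · exact (ne0 ha e.1).elim
        · exact (ne0 hb e.1).elim
      · rintro (rfl | e | e)
        · exact Or.inl rfl
        · rw [e.2.1] at hb; norm_num at hb
        · rw [e.2.1] at ha; norm_num at ha
    · simp only [q', if_pos ha, if_neg hb.not_ge]
      rw [mixed a b ha hb]
      refine ⟨fun h => Or.inr (Or.inl h), ?_⟩
      rintro (rfl | e | e)
      · exact (ha.not_gt hb).elim
      · exact e
      · rw [e.2.1] at ha; norm_num at ha
    · simp only [q', if_neg ha.not_ge, if_pos hb]
      rw [eq_comm, mixed b a hb ha]
      refine ⟨fun h => Or.inr (Or.inr h), ?_⟩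
      rintro (rfl | e | e)
      · exact (hb.not_gt ha).elim
      · rw [e.2.1] at hb; norm_num at hb
      · exact e
    · simp only [q', if_neg ha.not_ge, if_neg hb.not_ge]
      rw [h.eq_iff]
      have h1 := v₂ a ha.le
      have h2 := v₂ b hb.le
      constructor
      · rintro (e | e | e)
        · left
          have e1 : ((f₂ a).2 : ℝ) = (f₂ b).2 := by rw [e]
          exact Prod.ext (ρ.symm.injective (congrArg Prod.fst e :)) (Subtype.ext (by linarith))
        · exact (ne1 ha e.1).elim
        · exact (ne1 hb e.1).elim
      · rintro (rfl | e | e)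
        · exact Or.inl rfl
        · rw [e.1] at ha; norm_num at ha
        · rw [e.1] at hb; norm_num at hb
  · intro a
    rw [← circleLoop_add]
    rcases le_or_gt (a.2 : ℝ) (1 / 2) with ha | ha
    · simp only [q', if_pos ha]
      rw [hp, v₁ a ha, add_comm]
    · simp only [q', if_neg ha.not_ge]
      rw [hp, v₂ a ha.le, circleLoop_eq_iff]
      exact ⟨-1, by push_cast; ring⟩

/-- Two charts suffice: the gluing cut at parameter `0` covers all of the circle but `1`, and the
one cut at `1 / 2` covers a neighbourhood of `1`. -/
lemma IsGluing.isSphereBundleOverCircle [T2Space Z] {m : ℕ} {ρ : Sphere m ≃ₜ Sphere m}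
    {q : Sphere m × I → Z} (h : IsGluing ρ q) : IsSphereBundleOverCircle m Z := by
  have : Nonempty (Sphere m) := (NormedSpace.sphere_nonempty.2 zero_le_one).to_subtype
  have hc : Continuous fun a : Sphere m × I => circleLoop a.2 :=
    continuous_circleLoop.comp (continuous_subtype_val.comp continuous_snd)
  have hfac : ∀ a b, q a = q b → circleLoop a.2 = circleLoop b.2 := by
    intro a b hab
    rw [circleLoop_eq_iff_of_mem]
    rcases (h.eq_iff a b).1 hab with rfl | h | h
    · exact Or.inl rfl
    · exact Or.inr (Or.inl ⟨h.1, h.2.1⟩)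
    · exact Or.inr (Or.inr ⟨h.1, h.2.1⟩)
  let p : C(Z, Circle) := IsQuotientMap.lift (f := ⟨q, h.isQuotientMap.continuous⟩)
    h.isQuotientMap ⟨_, hc⟩ hfac
  have hp : ∀ a, p (q a) = circleLoop a.2 := fun a =>
    DFunLike.congr_fun (IsQuotientMap.lift_comp (f := ⟨q, h.isQuotientMap.continuous⟩)
      h.isQuotientMap ⟨_, hc⟩ hfac) a
  refine ⟨p, p.continuous, fun b => ?_⟩
  by_cases hb : b = 1
  · obtain ⟨q', hq', hp'⟩ := h.shift hp
    obtain ⟨e, he⟩ := hq'.exists_trivialization hp'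
    refine ⟨e, ?_⟩
    rw [he, hb, mem_compl_singleton_iff, ← circleLoop_zero, Ne, circleLoop_eq_iff]
    rintro ⟨m, hm⟩
    have h1 : (m : ℝ) * 2 = -1 := by linarith
    have h2 : m * 2 = -1 := by exact_mod_cast h1
    omega
  · obtain ⟨e, he⟩ := h.exists_trivialization (p := p) (b := 1) fun a => by rw [hp, one_mul]
    exact ⟨e, by rwa [he]⟩

end Bundle
end SphereBundles
namespace SphereBundles

open Set Topology unitInterval

/-! ### Isotopies of linear isometries and coordinate permutations -/

section Isotopy

variable {W : Type*} [NormedAddCommGroup W] [InnerProductSpace ℝ W]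

/-- Two linear isometries are isotopic if they are joined by a path of linear isometries. -/
def IsotopicIsometry (A B : W ≃ₗᵢ[ℝ] W) : Prop :=
  ∃ γ : I → W ≃ₗᵢ[ℝ] W, Continuous (fun p : I × W => γ p.1 p.2) ∧ γ 0 = A ∧ γ 1 = B

lemma IsotopicIsometry.refl (A : W ≃ₗᵢ[ℝ] W) : IsotopicIsometry A A :=
  ⟨fun _ => A, A.continuous.comp continuous_snd, rfl, rfl⟩

lemma IsotopicIsometry.mul {A B A' B' : W ≃ₗᵢ[ℝ] W} (h : IsotopicIsometry A B)
    (h' : IsotopicIsometry A' B') : IsotopicIsometry (A * A') (B * B') := by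
  obtain ⟨γ, hγ, rfl, rfl⟩ := h
  obtain ⟨γ', hγ', rfl, rfl⟩ := h'
  exact ⟨fun t => γ t * γ' t, hγ.comp (continuous_fst.prodMk hγ'), rfl, rfl⟩

lemma IsotopicIsometry.symm {A B : W ≃ₗᵢ[ℝ] W} (h : IsotopicIsometry A B) :
    IsotopicIsometry B A := by
  obtain ⟨γ, hγ, rfl, rfl⟩ := h
  exact ⟨fun t => γ (σ t), hγ.comp ((continuous_symm.comp continuous_fst).prodMk continuous_snd),
    by simp, by simp⟩

/-- The reflection in the hyperplane orthogonal to `v`. -/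
noncomputable def hyperplaneReflection (v : W) : W ≃ₗᵢ[ℝ] W := (Submodule.span ℝ {v})ᗮ.reflection

lemma hyperplaneReflection_apply (v x : W) :
    hyperplaneReflection v x = x - (2 * (inner ℝ v x / ‖v‖ ^ 2)) • v := by
  rw [hyperplaneReflection, Submodule.reflection_orthogonal_apply,
    Submodule.reflection_singleton_apply]
  simp only [RCLike.ofReal_real_eq_id, id, neg_sub, ← Nat.cast_smul_eq_nsmul ℝ, smul_smul]
  norm_num

lemma hyperplaneReflection_mul_self (v : W) :
    hyperplaneReflection v * hyperplaneReflection v = 1 := by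
  rw [hyperplaneReflection, Submodule.reflection_mul_reflection]

/-- The nonzero vectors are path connected in dimension above one, and a reflection depends
continuously on its normal vector. -/
lemma isotopicIsometry_reflection (hW : 1 < Module.rank ℝ W) {v w : W} (hv : v ≠ 0) (hw : w ≠ 0) :
    IsotopicIsometry (hyperplaneReflection v) (hyperplaneReflection w) := by
  obtain ⟨γ, hγ⟩ := (isPathConnected_compl_singleton_of_one_lt_rank hW (0 : W)).joinedIn v hv w hw
  refine ⟨fun t => hyperplaneReflection (γ t), ?_, by simp, by simp⟩
  simp only [hyperplaneReflection_apply]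
  have h1 : Continuous fun p : I × W => γ p.1 := γ.continuous.comp continuous_fst
  refine continuous_snd.sub (Continuous.smul (continuous_const.mul (Continuous.div ?_ ?_ ?_)) h1)
  · exact h1.inner continuous_snd
  · exact h1.norm.pow 2
  · intro p
    have := hγ p.1
    simpa using this

/-- The restriction of a linear isometry to the unit sphere. -/
def sphereMap (A : W ≃ₗᵢ[ℝ] W) : Metric.sphere (0 : W) 1 ≃ₜ Metric.sphere (0 : W) 1 where
  toFun x := ⟨A x, by simp⟩
  invFun x := ⟨A.symm x, by simp⟩
  left_inv x := by simp
  right_inv x := by simp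
  continuous_toFun := by fun_prop
  continuous_invFun := by fun_prop

lemma sphereMap_apply (A : W ≃ₗᵢ[ℝ] W) (x : Metric.sphere (0 : W) 1) :
    (sphereMap A x : W) = A x := rfl

lemma IsGluing.of_isotopicIsometry {Z : Type*} [TopologicalSpace Z] [T2Space Z]
    [FiniteDimensional ℝ W] {A B : W ≃ₗᵢ[ℝ] W} (h : IsotopicIsometry A B)
    {q : Metric.sphere (0 : W) 1 × I → Z} (hq : IsGluing (sphereMap A) q) :
    ∃ q' : Metric.sphere (0 : W) 1 × I → Z, IsGluing (sphereMap B) q' := by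
  have : ProperSpace W := FiniteDimensional.proper ℝ W
  -- A path from `B * B⁻¹ = 1` to `A * B⁻¹`, which carries `B x` to `A x` at its end.
  obtain ⟨γ, hγ, h0, h1⟩ := h.symm.mul (IsotopicIsometry.refl B⁻¹)
  refine ⟨_, hq.isotopy (h := fun t => sphereMap (γ t)) ?_ ?_ (fun t => (sphereMap (γ t)).bijective)
    ?_⟩
  · have : Continuous fun p : Metric.sphere (0 : W) 1 × I => (p.2, (p.1 : W)) := by fun_prop
    exact Continuous.subtype_mk (hγ.comp this) _
  · intro x
    rw [mul_inv_cancel] at h0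
    exact Subtype.ext (by rw [sphereMap_apply, h0]; rfl)
  · intro x
    refine Subtype.ext ?_
    rw [sphereMap_apply, h1, sphereMap_apply, sphereMap_apply]
    change A (B⁻¹ (B x)) = A x
    exact congrArg A (B.symm_apply_apply x)

/-- `A` is the permutation of coordinates `π` in the coordinate system `ι`. -/
def IsPermIsometry {κ : Type*} (ι : W → κ → ℝ) (π : Equiv.Perm κ) (A : W ≃ₗᵢ[ℝ] W) : Prop :=
  ∀ w k, ι (A w) k = ι w (π k)

/-- Permutations of coordinates of a hyperplane `∑ x_k = 0`, with coordinates `ι`, are isotopic to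
the identity or to any reflection, according to their sign. -/
lemma exists_isPermIsometry {κ : Type*} [Fintype κ] [DecidableEq κ] (hW : 1 < Module.rank ℝ W)
    (ι : W →ₗ[ℝ] κ → ℝ) (hinner : ∀ v w, inner ℝ v w = ∑ k, ι v k * ι w k)
    (hrange : ∀ y : κ → ℝ, ∑ k, y k = 0 → ∃ w, ι w = y) {e : W} (he : e ≠ 0)
    (π : Equiv.Perm κ) : ∃ A, IsPermIsometry ι π A ∧
      IsotopicIsometry A (if Equiv.Perm.sign π = 1 then 1 else hyperplaneReflection e) := by
  induction π using Equiv.Perm.swap_induction_on with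
  | one => exact ⟨1, fun _ _ => rfl, by simpa using IsotopicIsometry.refl _⟩
  | swap_mul π i j hij ih =>
    obtain ⟨A, hA, hiso⟩ := ih
    -- The reflection with normal vector `e_i - e_j`, of squared norm `2`, exchanges the coordinates
    -- `i` and `j`.
    obtain ⟨v, hv⟩ := hrange (Pi.single i 1 - Pi.single j 1) (by simp)
    have hvw : ∀ w, inner ℝ v w = ι w i - ι w j := fun w => by
      rw [hinner, hv]
      simp [sub_mul, Finset.sum_sub_distrib, Pi.single_apply]
    have hnorm : ‖v‖ ^ 2 = 2 := by
      rw [← real_inner_self_eq_norm_sq, hvw, hv]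
      simp [hij, hij.symm]; norm_num
    have hv0 : v ≠ 0 := fun h => by rw [h] at hnorm; simp at hnorm
    refine ⟨A * hyperplaneReflection v, ?_, ?_⟩
    · intro w k
      change ι (A (hyperplaneReflection v w)) k = _
      rw [hA, hyperplaneReflection_apply, hvw, hnorm, map_sub, map_smul, hv, Equiv.Perm.mul_apply,
        Equiv.swap_apply_def]
      simp only [Pi.sub_apply, Pi.smul_apply, smul_eq_mul, Pi.single_apply]
      split_ifs with h1 h2 h2
      · exact (hij (h1.symm.trans h2)).elim
      · rw [h1]; ring
      · rw [h2]; ring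
      · ring
    · have := hiso.mul (isotopicIsometry_reflection hW hv0 he)
      rw [Equiv.Perm.sign_mul, Equiv.Perm.sign_swap hij]
      rcases Int.units_eq_one_or (Equiv.Perm.sign π) with h | h <;> rw [h] at this ⊢
      · simpa using this
      · simpa [hyperplaneReflection_mul_self] using this

end Isotopy
end SphereBundles
namespace SphereBundles

open Finset

/-! ### Barycentric coordinates -/

section Realization

variable {V : Type*} [DecidableEq V]

lemma mem_realization {K : PreAbstractSimplicialComplex V} {p : V → ℝ} :
    p ∈ realization K ↔ ∃ s ∈ K.faces, (∀ v, 0 ≤ p v) ∧ (∀ v, v ∉ s → p v = 0) ∧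
      ∑ v ∈ s, p v = 1 := by
  classical
  have hcomb : ∀ (s : Finset V) (w : V → ℝ) (v : V),
      (∑ x ∈ s, w x • (Pi.single x 1 : V → ℝ)) v = if v ∈ s then w v else 0 := by
    intro s w v
    simp [Finset.sum_apply, Pi.single_apply]
  simp only [realization, Set.mem_iUnion, exists_prop]
  refine exists_congr fun s => and_congr_right fun _ => ?_
  rw [← coe_image, Finset.convexHull_eq]
  simp only [Set.mem_ofPred_eq]
  have hinj : Function.Injective (fun v : V => (Pi.single v 1 : V → ℝ)) := fun a b h => by
    by_contra hab
    have := congrFun h a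
    simp [hab] at this
  constructor
  · rintro ⟨w, hw0, hw1, rfl⟩
    rw [sum_image hinj.injOn] at hw1
    rw [centerMass_eq_of_sum_1 _ _ (by rw [sum_image hinj.injOn]; exact hw1),
      sum_image hinj.injOn]
    simp only [id]
    have h := hcomb s fun x => w (Pi.single x 1)
    refine ⟨fun v => ?_, fun v hv => ?_, ?_⟩
    · rw [h]
      split_ifs with hv
      · exact hw0 _ (mem_image_of_mem _ hv)
      · exact le_rfl
    · rw [h, if_neg hv]
    · exact (sum_congr rfl fun v hv => by rw [h, if_pos hv]).trans hw1
  · rintro ⟨h0, h1, h2⟩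
    -- The convex hull is taken over a set of vectors, so the weights have to be indexed by vectors;
    -- the sum picks out `p x` at `e_x`.
    let w : (V → ℝ) → ℝ := fun y => ∑ x ∈ s, if y = Pi.single x 1 then p x else 0
    have hw : ∀ v ∈ s, w (Pi.single v 1) = p v := fun v hv => by
      have : ∀ x : V, (Pi.single v 1 : V → ℝ) = Pi.single x 1 ↔ v = x := fun x =>
        ⟨fun h => hinj h, fun h => by rw [h]⟩
      simp only [w, this]
      rw [sum_ite_eq, if_pos hv]
    have hsum : ∑ y ∈ s.image (fun v : V => (Pi.single v 1 : V → ℝ)), w y = 1 := by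
      rw [sum_image hinj.injOn]
      exact (sum_congr rfl hw).trans h2
    refine ⟨w, ?_, hsum, ?_⟩
    · intro y hy
      obtain ⟨v, hv, rfl⟩ := mem_image.1 hy
      rw [hw v hv]; exact h0 v
    · rw [centerMass_eq_of_sum_1 _ _ hsum, sum_image hinj.injOn]
      ext v
      simp only [id]
      rw [hcomb s fun x => w (Pi.single x 1)]
      split_ifs with hv
      · exact hw v hv
      · exact (h1 v hv).symm

end Realization

/-! ### The sliding unit interval -/

section StackPoint

variable {n : ℕ}

/-- A point of the boundary of the simplex with vertex set `ZMod n`. -/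
structure IsBoundaryPoint [NeZero n] (c : ZMod n → ℝ) : Prop where
  nonneg : ∀ k, 0 ≤ c k
  sum_eq : ∑ k, c k = 1
  exists_zero : ∃ k, c k = 0

/-- The sums `c 0 + ⋯ + c (v - 1)`, indices taken modulo `n`. -/
def partialSum (c : ZMod n → ℝ) (v : ℕ) : ℝ := ∑ l ∈ range v, c (l : ZMod n)

/-- The point of `[u, u + 1]` next to `y`. -/
noncomputable def clampUnit (u y : ℝ) : ℝ := max u (min y (u + 1))

/-- The point with coordinates the lengths of `[S v, S (v + 1)] ∩ [u, u + 1]`, where `S` denotes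
the partial sums of `c`. -/
noncomputable def stackPoint (c : ZMod n → ℝ) (u : ℝ) (v : ℕ) : ℝ :=
  clampUnit u (partialSum c (v + 1)) - clampUnit u (partialSum c v)

/-- The parameter at time `τ` of the path that moves through all windows up to that of `m`. -/
noncomputable def stackParameter (c : ZMod n → ℝ) (m : ℕ) (τ : ℝ) : ℝ :=
  partialSum c 1 + τ * (partialSum c (m + 1) - partialSum c 1)

/-- The sum of the values of `p` at the numbers less than `m` that are congruent to `k`. -/
def colorSum (n m : ℕ) (p : ℕ → ℝ) (k : ZMod n) : ℝ :=
  ∑ v ∈ range m, if (v : ZMod n) = k then p v else 0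

/-- Congruence in a linear form: vertices of one window have the same colour only if they are equal
or are its two ends. -/
lemma natCast_zmod_cases {a b : ℕ} (h : (a : ZMod n) = b) :
    a = b ∨ a = b + n ∨ b = a + n ∨ a + 2 * n ≤ b ∨ b + 2 * n ≤ a := by
  have key : ∀ {a b : ℕ}, a ≤ b → (a : ZMod n) = b → a = b ∨ b = a + n ∨ a + 2 * n ≤ b := by
    intro a b hab h
    rw [ZMod.natCast_eq_natCast_iff, Nat.modEq_iff_dvd' hab] at h
    obtain ⟨m, hm⟩ := h
    match m with
    | 0 => omega
    | 1 => omega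
    | m + 2 =>
      have : n * (m + 2) = n * m + 2 * n := by ring
      omega
  rcases le_total a b with hab | hab
  · have := key hab h; omega
  · have := key hab h.symm; omega

lemma exists_natCast_zmod [NeZero n] (j : ℕ) (k : ZMod n) :
    ∃ v : ℕ, j ≤ v ∧ v < j + n ∧ (v : ZMod n) = k :=
  ⟨j + (k - (j : ZMod n)).val, by omega, by
    have := ZMod.val_lt (k - (j : ZMod n))
    omega, by
    rw [Nat.cast_add, ZMod.natCast_zmod_val]; ring⟩

lemma partialSum_succ (c : ZMod n → ℝ) (v : ℕ) :
    partialSum c (v + 1) = partialSum c v + c v := sum_range_succ _ _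

lemma clampUnit_of_le {u y : ℝ} (h : y ≤ u) : clampUnit u y = u := by
  rw [clampUnit, max_eq_left]; exact (min_le_left _ _).trans h

lemma clampUnit_of_ge {u y : ℝ} (h : u + 1 ≤ y) : clampUnit u y = u + 1 := by
  rw [clampUnit, min_eq_right h, max_eq_right]; linarith

lemma clampUnit_of_mem {u y : ℝ} (h : u ≤ y) (h' : y ≤ u + 1) : clampUnit u y = y := by
  rw [clampUnit, min_eq_left h', max_eq_right h]

namespace IsBoundaryPoint

variable [NeZero n] {c c' : ZMod n → ℝ}

lemma partialSum_mono (hc : IsBoundaryPoint c) : Monotone (partialSum c) :=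
  monotone_nat_of_le_succ fun v => by
    rw [partialSum_succ]; exact le_add_of_nonneg_right (hc.nonneg _)

lemma partialSum_add (hc : IsBoundaryPoint c) (v : ℕ) :
    partialSum c (v + n) = partialSum c v + 1 := by
  induction v with
  | zero =>
    rw [zero_add, partialSum, partialSum, range_zero, sum_empty, zero_add, ← hc.sum_eq]
    exact sum_nbij' (fun l => (l : ZMod n)) ZMod.val (fun _ _ => mem_univ _)
      (fun k _ => mem_range.2 (ZMod.val_lt k))
      (fun l hl => ZMod.val_cast_of_lt (mem_range.1 hl)) (fun k _ => ZMod.natCast_zmod_val k)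
      (fun _ _ => rfl)
  | succ v ih =>
    rw [add_right_comm, partialSum_succ, ih, partialSum_succ, Nat.cast_add, ZMod.natCast_self,
      add_zero]
    ring

/-- The coordinates of `stackPoint c u` when `u` lies in the window of `j`. -/
lemma stackPoint_eq (hc : IsBoundaryPoint c) (hn : 2 ≤ n) {u : ℝ} {j : ℕ}
    (h1 : partialSum c j ≤ u) (h2 : u ≤ partialSum c (j + 1)) (v : ℕ) :
    stackPoint c u v = if v = j then partialSum c (j + 1) - u
      else if v = j + n then u - partialSum c j
      else if j < v ∧ v < j + n then c v else 0 := by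
  -- The partial sums up to `j` lie left of `[u, u + 1]`, the next `n` lie inside, and the rest lie
  -- to the right, because `n` steps raise the sum by exactly one.
  have hlow : ∀ v, v ≤ j → clampUnit u (partialSum c v) = u := fun v hv =>
    clampUnit_of_le ((hc.partialSum_mono hv).trans h1)
  have hmid : ∀ v, j + 1 ≤ v → v ≤ j + n → clampUnit u (partialSum c v) = partialSum c v :=
    fun v hv hv' => clampUnit_of_mem (h2.trans (hc.partialSum_mono hv))
      ((hc.partialSum_mono hv').trans (by rw [hc.partialSum_add]; linarith))
  have hhigh : ∀ v, j + n + 1 ≤ v → clampUnit u (partialSum c v) = u + 1 := fun v hv =>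
    clampUnit_of_ge (le_trans (by rw [add_right_comm, hc.partialSum_add]; linarith)
      (hc.partialSum_mono hv))
  rw [stackPoint]
  split_ifs with h h h
  · rw [hmid _ (by omega) (by omega), hlow _ (by omega), h]
  · rw [hhigh _ (by omega), hmid _ (by omega) (by omega), h, hc.partialSum_add]; ring
  · rw [hmid _ (by omega) (by omega), hmid _ (by omega) (by omega), partialSum_succ]; ring
  · rcases lt_or_ge v j with hv | hv
    · rw [hlow _ (by omega), hlow _ (by omega), sub_self]
    · rw [hhigh _ (by omega), hhigh _ (by omega), sub_self]

lemma stackPoint_nonneg (hc : IsBoundaryPoint c) (u : ℝ) (v : ℕ) : 0 ≤ stackPoint c u v :=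
  sub_nonneg.2 (max_le_max le_rfl (min_le_min (hc.partialSum_mono v.le_succ) le_rfl))

lemma stackPoint_le (hc : IsBoundaryPoint c) (u : ℝ) (v : ℕ) : stackPoint c u v ≤ c v := by
  rw [stackPoint, partialSum_succ, clampUnit, clampUnit]
  have := hc.nonneg v
  rcases max_cases u (min (partialSum c v + c v) (u + 1)) with h | h <;>
  rcases max_cases u (min (partialSum c v) (u + 1)) with h' | h' <;>
  rcases min_cases (partialSum c v + c v) (u + 1) with h'' | h'' <;>
  rcases min_cases (partialSum c v) (u + 1) with h''' | h''' <;> linarith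

lemma stackPoint_eq_zero (hc : IsBoundaryPoint c) (u : ℝ) {v : ℕ} (h : c v = 0) :
    stackPoint c u v = 0 :=
  le_antisymm (h ▸ hc.stackPoint_le u v) (hc.stackPoint_nonneg u v)

/-- Every parameter lies in a window. -/
lemma exists_window {u : ℝ} {m : ℕ} (hm : 1 ≤ m) (h1 : partialSum c 1 ≤ u)
    (h2 : u ≤ partialSum c (m + 1)) (hc : IsBoundaryPoint c) :
    ∃ j, 1 ≤ j ∧ j ≤ m ∧ partialSum c j ≤ u ∧ u ≤ partialSum c (j + 1) ∧
      (u < partialSum c (m + 1) → u < partialSum c (j + 1)) := by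
  rcases h2.eq_or_lt with rfl | h2
  · exact ⟨m, hm, le_rfl, hc.partialSum_mono m.le_succ, le_rfl, id⟩
  classical
  -- The first window whose right end lies strictly beyond `u`; the strictness keeps the coordinate
  -- at `j` positive, as injectivity will need.
  have hex : ∃ j, u < partialSum c (j + 1) := ⟨m, h2⟩
  have h3 := Nat.find_spec hex
  have h4 : Nat.find hex ≠ 0 := fun h => by rw [h] at h3; exact (h1.trans_lt h3).false
  obtain ⟨j, hj⟩ := Nat.exists_eq_succ_of_ne_zero h4
  refine ⟨Nat.find hex, by omega, Nat.find_min' hex h2, ?_, h3.le, fun _ => h3⟩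
  have := Nat.find_min hex (m := j) (by omega)
  rw [hj]; exact not_lt.1 this

end IsBoundaryPoint

section ColorSum

variable {m j : ℕ} {p : ℕ → ℝ}

lemma colorSum_of_mem (hp : ∀ v, p v ≠ 0 → j ≤ v ∧ v ≤ j + n) (hm : j + n < m) {v : ℕ}
    (h1 : j < v) (h2 : v < j + n) : colorSum n m p v = p v := by
  rw [colorSum, sum_eq_single v, if_pos rfl]
  · intro b _ hb
    rw [ite_eq_right_iff]
    intro h
    by_contra hb'
    have := hp b hb'
    have := natCast_zmod_cases h
    omega
  · intro h; rw [mem_range] at h; omega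

lemma colorSum_left (hn : 1 ≤ n) (hp : ∀ v, p v ≠ 0 → j ≤ v ∧ v ≤ j + n) (hm : j + n < m) :
    colorSum n m p j = p j + p (j + n) := by
  rw [colorSum, sum_eq_add j (j + n) (by omega), if_pos rfl, if_pos (by simp)]
  · intro b _ hb
    rw [ite_eq_right_iff]
    intro h
    by_contra hb'
    have := hp b hb'
    have := natCast_zmod_cases h
    omega
  · intro h; rw [mem_range] at h; omega
  · intro h; rw [mem_range] at h; omega

lemma colorSum_nonneg (hp : ∀ v, 0 ≤ p v) (k : ZMod n) : 0 ≤ colorSum n m p k :=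
  sum_nonneg fun v _ => by split_ifs <;> simp [hp v]

lemma sum_colorSum [NeZero n] : ∑ k, colorSum n m p k = ∑ v ∈ range m, p v := by
  simp only [colorSum]
  rw [sum_comm]
  simp

end ColorSum

namespace IsBoundaryPoint

variable [NeZero n] {c c' : ZMod n → ℝ}

/-- A unit interval covers one full period: inner colours are covered whole, and the pieces at `j`
and `j + n` add up to `c j`. -/
lemma colorSum_stackPoint (hc : IsBoundaryPoint c) (hn : 2 ≤ n) {u : ℝ} {j m : ℕ}
    (h1 : partialSum c j ≤ u) (h2 : u ≤ partialSum c (j + 1)) (hm : j + n < m) :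
    colorSum n m (stackPoint c u) = c := by
  have hp : ∀ v, stackPoint c u v ≠ 0 → j ≤ v ∧ v ≤ j + n := by
    intro v hv
    rw [hc.stackPoint_eq hn h1 h2] at hv
    split_ifs at hv
    all_goals first | exact (hv rfl).elim | omega
  ext k
  obtain ⟨v, hv1, hv2, rfl⟩ := exists_natCast_zmod j k
  rcases hv1.eq_or_lt with rfl | hv1
  · rw [colorSum_left (by omega) hp hm, hc.stackPoint_eq hn h1 h2, hc.stackPoint_eq hn h1 h2,
      if_pos rfl, if_neg (by omega), if_pos rfl, partialSum_succ]
    ring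
  · rw [colorSum_of_mem hp hm hv1 hv2, hc.stackPoint_eq hn h1 h2, if_neg (by omega),
      if_neg (by omega), if_pos ⟨hv1, hv2⟩]

/-- The colour sums recover `c`. Then `u` is read off the coordinate at the left end of its window,
which drops strictly as `u` grows while it is positive. -/
lemma stackPoint_injective (hc : IsBoundaryPoint c) (hc' : IsBoundaryPoint c') (hn : 2 ≤ n)
    {m : ℕ} (hm : 1 ≤ m) {u u' : ℝ} (h1 : partialSum c 1 ≤ u) (h2 : u ≤ partialSum c (m + 1))
    (h1' : partialSum c' 1 ≤ u') (h2' : u' ≤ partialSum c' (m + 1))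
    (h : stackPoint c u = stackPoint c' u') : c = c' ∧ u = u' := by
  obtain ⟨j, -, hj, h3, h4, h5⟩ := hc.exists_window hm h1 h2
  obtain ⟨j', -, hj', h3', h4', h5'⟩ := hc'.exists_window hm h1' h2'
  have e : c = c' := by
    rw [← hc.colorSum_stackPoint hn h3 h4 (m := m + n + 1) (by omega), h,
      hc'.colorSum_stackPoint hn h3' h4' (by omega)]
  subst e
  refine ⟨rfl, ?_⟩
  have key : ∀ {u u' : ℝ} {j : ℕ}, stackPoint c u = stackPoint c u' → u < u' →
      partialSum c j ≤ u → u < partialSum c (j + 1) → False := by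
    intro u u' j h hlt h3 h4
    have e := congrFun h j
    rw [hc.stackPoint_eq hn h3 h4.le, if_pos rfl, stackPoint,
      clampUnit_of_le (h3.trans hlt.le)] at e
    rcases le_total (partialSum c (j + 1)) u' with h6 | h6
    · rw [clampUnit_of_le h6] at e; linarith
    · rw [clampUnit_of_mem h6] at e
      · linarith
      · have := hc.partialSum_mono (show j + 1 ≤ j + n by omega)
        rw [hc.partialSum_add] at this
        linarith
  by_contra hne
  rcases lt_or_gt_of_ne hne with hlt | hlt
  · exact key h hlt h3 (h5 (hlt.trans_le h2'))
  · exact key h.symm hlt h3' (h5' (hlt.trans_le h2))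

/-- A nonnegative function supported on `{j, …, j + n}` whose colour sums form a boundary point is
a stack point. -/
lemma stackPoint_colorSum (hn : 2 ≤ n) {p : ℕ → ℝ} {j m : ℕ} (h0 : ∀ v, 0 ≤ p v)
    (hp : ∀ v, p v ≠ 0 → j ≤ v ∧ v ≤ j + n) (hm : j + n < m)
    (hc : IsBoundaryPoint (colorSum n m p)) :
    stackPoint (colorSum n m p) (partialSum (colorSum n m p) j + p (j + n)) = p ∧
      partialSum (colorSum n m p) j + p (j + n) ≤ partialSum (colorSum n m p) (j + 1) := by
  -- The parameter is forced: at `j + n` a stack point has the coordinate `u - partialSum c j`.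
  have h1 := h0 (j + n)
  have h2 := h0 j
  have h3 := colorSum_left (by omega) hp hm
  have h4 := partialSum_succ (colorSum n m p) j
  have hle : partialSum (colorSum n m p) j + p (j + n) ≤ partialSum (colorSum n m p) (j + 1) := by
    linarith
  refine ⟨?_, hle⟩
  ext v
  rw [hc.stackPoint_eq hn (by linarith) hle]
  split_ifs with hv hv hv
  · rw [hv]; linarith
  · rw [hv]; ring
  · exact colorSum_of_mem hp hm hv.1 hv.2
  · by_contra hne
    have := hp v (Ne.symm hne)
    omega

lemma partialSum_lt (hc : IsBoundaryPoint c) {m : ℕ} (hm : n ≤ m) :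
    partialSum c 1 < partialSum c (m + 1) := by
  have h1 := hc.partialSum_mono (show 1 + n ≤ m + 1 by omega)
  rw [hc.partialSum_add] at h1
  linarith

lemma stackParameter_mem (hc : IsBoundaryPoint c) {m : ℕ} (hm : n ≤ m) {τ : ℝ} (h0 : 0 ≤ τ)
    (h1 : τ ≤ 1) :
    partialSum c 1 ≤ stackParameter c m τ ∧ stackParameter c m τ ≤ partialSum c (m + 1) := by
  have := hc.partialSum_lt hm
  rw [stackParameter]
  constructor <;> nlinarith

lemma exists_stackParameter (hc : IsBoundaryPoint c) {m : ℕ} (hm : n ≤ m) {u : ℝ}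
    (h1 : partialSum c 1 ≤ u) (h2 : u ≤ partialSum c (m + 1)) :
    ∃ τ : unitInterval, stackParameter c m τ = u := by
  have h := sub_pos.2 (hc.partialSum_lt hm)
  refine ⟨⟨(u - partialSum c 1) / (partialSum c (m + 1) - partialSum c 1),
    div_nonneg (by linarith) h.le, (div_le_one h).2 (by linarith)⟩, ?_⟩
  rw [stackParameter, div_mul_cancel₀ _ h.ne']; ring

end IsBoundaryPoint

end StackPoint

end SphereBundles
namespace SphereBundles

open Finset

/-! ### The stacked sphere without two facets as a cylinder -/

section OpenDelta

variable {n : ℕ}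

/-- `Delta n (2 * n + 2)` without the facets that are to be identified. -/
def openDelta (n : ℕ) : PreAbstractSimplicialComplex ℕ :=
  removeFace (removeFace (Delta n (2 * n + 2)) (firstFacet n)) (lastFacet n)

lemma mem_openDelta {s : Finset ℕ} : s ∈ (openDelta n).faces ↔
    s ∈ (Delta n (2 * n + 2)).faces ∧ ¬ firstFacet n ⊆ s ∧ ¬ lastFacet n ⊆ s := and_assoc

lemma subset_range_of_mem (hn : 2 ≤ n) {s : Finset ℕ} (hs : s ∈ (Delta n (2 * n + 2)).faces) :
    s ⊆ range (3 * n + 3) := by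
  obtain ⟨-, j, x, h⟩ := (mem_delta_faces (by omega) hn).1 hs
  intro v hv
  have := h.mem v hv; have := h.le
  rw [mem_range]; omega

end OpenDelta

section StackPath

variable {n : ℕ} [NeZero n] {c c' : ZMod n → ℝ}

/-- The stack point over `c` at time `τ` in `Delta n (2 * n + 2)`. -/
noncomputable def stackPath (c : ZMod n → ℝ) (τ : ℝ) : ℕ → ℝ :=
  stackPoint c (stackParameter c (2 * n + 2) τ)

namespace IsBoundaryPoint

lemma exists_window_stackPath (hc : IsBoundaryPoint c) (τ : unitInterval) :
    ∃ j, 1 ≤ j ∧ j ≤ 2 * n + 2 ∧ partialSum c j ≤ stackParameter c (2 * n + 2) τ ∧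
      stackParameter c (2 * n + 2) τ ≤ partialSum c (j + 1) := by
  obtain ⟨h1, h2⟩ := hc.stackParameter_mem (m := 2 * n + 2) (by omega) τ.2.1 τ.2.2
  obtain ⟨j, h3, h4, h5, h6, -⟩ := hc.exists_window (by omega) h1 h2
  exact ⟨j, h3, h4, h5, h6⟩

lemma colorSum_stackPath (hc : IsBoundaryPoint c) (hn : 2 ≤ n) (τ : unitInterval) :
    colorSum n (3 * n + 3) (stackPath c τ) = c := by
  obtain ⟨j, h3, h4, h5, h6⟩ := hc.exists_window_stackPath τ
  exact hc.colorSum_stackPoint hn h5 h6 (by omega)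

/-- No vertex whose colour is a zero of `c` carries weight, and any `n` consecutive vertices include
one of that colour. So the support contains neither `F` nor `G` nor a whole facet between two
windows. -/
lemma stackPath_mem (hc : IsBoundaryPoint c) (hn : 2 ≤ n) (τ : unitInterval) :
    stackPath c τ ∈ realization (openDelta n) := by
  obtain ⟨j, h3, h4, h5, h6⟩ := hc.exists_window_stackPath τ
  have hsupp : ∀ v, stackPath c τ v ≠ 0 → j ≤ v ∧ v ≤ j + n := by
    intro v hv
    rw [stackPath, hc.stackPoint_eq hn h5 h6] at hv
    split_ifs at hv
    all_goals first | exact (hv rfl).elim | omega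
  have hzero : ∀ {v : ℕ}, c v = 0 → stackPath c τ v = 0 := fun h => hc.stackPoint_eq_zero _ h
  obtain ⟨k, hk⟩ := hc.exists_zero
  let s := (range (3 * n + 3)).filter (fun v => stackPath c τ v ≠ 0)
  have hs0 : ∀ v, v ∉ s → stackPath c τ v = 0 := by
    intro v hv
    by_contra hne
    have := hsupp v hne
    exact hv (mem_filter.2 ⟨mem_range.2 (by omega), hne⟩)
  have hs1 : ∀ v ∈ s, j ≤ v ∧ v ≤ j + n := fun v hv => hsupp v (mem_filter.1 hv).2
  have hs2 : ∀ v ∈ s, (v : ZMod n) ≠ k := fun v hv e =>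
    (mem_filter.1 hv).2 (hzero (by rw [e, hk]))
  have hsum : ∑ v ∈ s, stackPath c τ v = 1 := by
    rw [← hc.sum_eq, ← hc.colorSum_stackPath hn τ, sum_colorSum, hc.colorSum_stackPath hn τ]
    exact sum_filter_ne_zero _
  have hne : s.Nonempty := by
    rw [nonempty_iff_ne_empty]
    intro h
    rw [h, sum_empty] at hsum
    exact zero_ne_one hsum
  refine mem_realization.2 ⟨s, mem_openDelta.2 ⟨(mem_delta_faces (by omega) hn).2 ⟨hne, ?_⟩,
    fun h => ?_, fun h => ?_⟩, fun v => hc.stackPoint_nonneg _ v, hs0, hsum⟩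
  · obtain ⟨x, hx1, hx2, hx⟩ := exists_natCast_zmod j k
    rcases hx1.eq_or_lt with rfl | hx1
    · have hj : ∀ v ∈ s, v ≠ j ∧ v ≠ j + n := fun v hv =>
        ⟨fun e => hs2 v hv (e ▸ hx), fun e => hs2 v hv (by rw [e, ← hx]; simp)⟩
      -- Both ends of the window are missing. Unless it is the last one, the facet missing its left
      -- end is interior, so the face is placed in the next window, where it misses `j + n`.
      by_cases hjN : j = 2 * n + 2
      · refine ⟨j, j, h3, h4, le_rfl, by omega, fun _ => hjN, fun _ => by omega, fun v hv => ?_⟩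
        have := hs1 v hv; have := hj v hv
        omega
      · refine ⟨j + 1, j + n, by omega, by omega, by omega, by omega, fun _ => by omega,
          fun _ => by omega, fun v hv => ?_⟩
        have := hs1 v hv; have := hj v hv
        omega
    · refine ⟨j, x, h3, h4, by omega, by omega, fun _ => by omega, fun _ => by omega,
        fun v hv => ?_⟩
      have := hs1 v hv
      exact ⟨this.1, this.2, fun e => hs2 v hv (e ▸ hx)⟩
  · obtain ⟨x, hx1, hx2, hx⟩ := exists_natCast_zmod 1 k
    exact hs2 x (h (mem_firstFacet.2 (by omega))) hx
  · obtain ⟨x, hx1, hx2, hx⟩ := exists_natCast_zmod (2 * n + 3) k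
    exact hs2 x (h (mem_lastFacet.2 (by omega))) hx

lemma stackPath_injective (hc : IsBoundaryPoint c) (hc' : IsBoundaryPoint c') (hn : 2 ≤ n)
    {τ τ' : unitInterval} (h : stackPath c τ = stackPath c' τ') : c = c' ∧ τ = τ' := by
  obtain ⟨h1, h2⟩ := hc.stackParameter_mem (m := 2 * n + 2) (by omega) τ.2.1 τ.2.2
  obtain ⟨h1', h2'⟩ := hc'.stackParameter_mem (m := 2 * n + 2) (by omega) τ'.2.1 τ'.2.2
  obtain ⟨rfl, e⟩ := hc.stackPoint_injective hc' hn (by omega) h1 h2 h1' h2' h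
  refine ⟨rfl, Subtype.ext ?_⟩
  have hlt := sub_pos.2 (hc.partialSum_lt (m := 2 * n + 2) (by omega))
  rw [stackParameter, stackParameter, add_right_inj] at e
  exact mul_right_cancel₀ hlt.ne' e

lemma stackPoint_partialSum (hc : IsBoundaryPoint c) (hn : 2 ≤ n) (j v : ℕ) :
    stackPoint c (partialSum c j) v = if j ≤ v ∧ v < j + n then c v else 0 := by
  rw [hc.stackPoint_eq hn le_rfl (hc.partialSum_mono j.le_succ), partialSum_succ]
  have : v = j ∨ v = j + n ∨ (j < v ∧ v < j + n) ∨ (v < j ∨ j + n < v) := by omega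
  rcases this with rfl | rfl | h | h
  · rw [if_pos rfl, if_pos (by omega)]; ring
  · rw [if_neg (by omega), if_pos rfl, if_neg (by omega), sub_self]
  · rw [if_neg (by omega), if_neg (by omega), if_pos h, if_pos (by omega)]
  · rw [if_neg (by omega), if_neg (by omega), if_neg (by omega), if_neg (by omega)]

lemma stackPath_zero (hc : IsBoundaryPoint c) (hn : 2 ≤ n) (v : ℕ) :
    stackPath c 0 v = if v ∈ firstFacet n then c v else 0 := by
  rw [stackPath, stackParameter, zero_mul, add_zero, hc.stackPoint_partialSum hn]
  refine if_congr ?_ rfl rfl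
  rw [mem_firstFacet]; omega

lemma stackPath_one (hc : IsBoundaryPoint c) (hn : 2 ≤ n) (v : ℕ) :
    stackPath c 1 v = if v ∈ lastFacet n then c v else 0 := by
  rw [stackPath, stackParameter, one_mul, add_sub_cancel, hc.stackPoint_partialSum hn]
  refine if_congr ?_ rfl rfl
  rw [mem_lastFacet]; omega

/-- In `n` consecutive vertices each colour occurs once, so the coordinates are the values of `c`.
By injectivity the arcs therefore meet `F` and `G` only at their ends. -/
lemma eq_stackPoint_of_supp (hc : IsBoundaryPoint c) (hn : 2 ≤ n) {τ : unitInterval} {j : ℕ}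
    (hj0 : 1 ≤ j) (hj : j ≤ 2 * n + 3) (h : ∀ v, stackPath c τ v ≠ 0 → j ≤ v ∧ v < j + n) :
    stackPath c τ = stackPoint c (partialSum c j) := by
  -- The window of `j - 1` also contains the support, and its vertices stay below `3n + 3` even for
  -- `j = 2n + 3`.
  have h' : ∀ v, stackPath c τ v ≠ 0 → j - 1 ≤ v ∧ v ≤ j - 1 + n := fun v hv => by
    have := h v hv; omega
  ext v
  rw [hc.stackPoint_partialSum hn]
  split_ifs with hv
  · have e := hc.colorSum_stackPath hn τ
    rcases Nat.lt_or_ge (v + 1) (j + n) with hv' | hv'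
    · have h1 := colorSum_of_mem (n := n) (m := 3 * n + 3) h' (by omega) (v := v) (by omega)
        (by omega)
      rw [e] at h1
      exact h1.symm
    · have h1 := colorSum_left (n := n) (m := 3 * n + 3) (by omega) h' (by omega)
      have h2 : stackPath c τ (j - 1) = 0 := by
        by_contra h3
        have := h _ h3
        omega
      obtain rfl : v = j - 1 + n := by omega
      rw [e, h2, zero_add] at h1
      rw [← h1]; simp
  · by_contra h3
    exact hv (h v h3)

lemma eq_zero_of_supp (hc : IsBoundaryPoint c) (hn : 2 ≤ n) {τ : unitInterval}
    (h : ∀ v, stackPath c τ v ≠ 0 → v ∈ firstFacet n) : τ = 0 := by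
  refine (hc.stackPath_injective hc hn (τ' := 0) ?_).2
  rw [hc.eq_stackPoint_of_supp hn (j := 1) le_rfl (by omega) fun v hv => by
    have := mem_firstFacet.1 (h v hv); omega]
  ext v
  rw [hc.stackPoint_partialSum hn, Set.Icc.coe_zero, hc.stackPath_zero hn]
  refine if_congr ?_ rfl rfl
  rw [mem_firstFacet]; omega

lemma eq_one_of_supp (hc : IsBoundaryPoint c) (hn : 2 ≤ n) {τ : unitInterval}
    (h : ∀ v, stackPath c τ v ≠ 0 → v ∈ lastFacet n) : τ = 1 := by
  refine (hc.stackPath_injective hc hn (τ' := 1) ?_).2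
  rw [hc.eq_stackPoint_of_supp hn (j := 2 * n + 3) (by omega) (by omega) fun v hv => by
    have := mem_lastFacet.1 (h v hv); omega]
  ext v
  rw [hc.stackPoint_partialSum hn, Set.Icc.coe_one, hc.stackPath_one hn]
  refine if_congr ?_ rfl rfl
  rw [mem_lastFacet]; omega

end IsBoundaryPoint

/-- The base point has to be given by the colour sums. Some colour sum vanishes: the face misses an
inner vertex of its window, or it lies in `F` or `G` and misses a further vertex because these
facets are removed. -/
lemma exists_stackPath_eq (hn : 2 ≤ n) {p : ℕ → ℝ} (hp : p ∈ realization (openDelta n)) :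
    ∃ c : ZMod n → ℝ, IsBoundaryPoint c ∧ ∃ τ : unitInterval, stackPath c τ = p := by
  obtain ⟨s, hs, h0, h1, hsum⟩ := mem_realization.1 hp
  obtain ⟨hsΔ, hF, hG⟩ := mem_openDelta.1 hs
  obtain ⟨hne, j, x, h⟩ := (mem_delta_faces (by omega) hn).1 hsΔ
  have a1 := h.one_le; have a2 := h.le; have a3 := h.le_gap; have a4 := h.gap_le
  have a5 := h.left; have a6 := h.right
  have hsupp : ∀ v, p v ≠ 0 → j ≤ v ∧ v ≤ j + n := fun v hv => by
    have := h.mem v (not_not.1 fun hvs => hv (h1 v hvs))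
    exact ⟨this.1, this.2.1⟩
  have hpx : p x = 0 := h1 x fun hx => (h.mem x hx).2.2 rfl
  have hinner : ∀ v, j < v → v < j + n → colorSum n (3 * n + 3) p v = p v := fun v h2 h3 =>
    colorSum_of_mem hsupp (by omega) h2 h3
  have hleft : colorSum n (3 * n + 3) p j = p j + p (j + n) :=
    colorSum_left (by omega) hsupp (by omega)
  have hzero : ∃ k, colorSum n (3 * n + 3) p k = 0 := by
    have key : ∀ y, p y = 0 → j < y → y < j + n → ∃ k, colorSum n (3 * n + 3) p k = 0 :=
      fun y hy h2 h3 => ⟨y, by rw [hinner y h2 h3, hy]⟩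
    by_cases hx : x = j
    · obtain ⟨y, hyG, hys⟩ := not_subset.1 hG
      rw [mem_lastFacet] at hyG
      by_cases hy : y = j + n
      · exact ⟨j, by rw [hleft, ← hx, hpx, hx, ← hy, h1 y hys, add_zero]⟩
      · exact key y (h1 y hys) (by omega) (by omega)
    · by_cases hx' : x = j + n
      · obtain ⟨y, hyF, hys⟩ := not_subset.1 hF
        rw [mem_firstFacet] at hyF
        by_cases hy : y = j
        · exact ⟨j, by rw [hleft, ← hx', hpx, ← hy, h1 y hys, add_zero]⟩
        · exact key y (h1 y hys) (by omega) (by omega)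
      · exact key x hpx (by omega) (by omega)
  have hc : IsBoundaryPoint (colorSum n (3 * n + 3) p) := by
    refine ⟨colorSum_nonneg h0, ?_, hzero⟩
    rw [sum_colorSum, ← hsum]
    exact (sum_subset (subset_range_of_mem hn hsΔ) fun v _ hv => h1 v hv).symm
  obtain ⟨e, hle⟩ := IsBoundaryPoint.stackPoint_colorSum hn h0 hsupp (by omega) hc
  obtain ⟨τ, hτ⟩ := hc.exists_stackParameter (m := 2 * n + 2) (by omega)
    (u := partialSum (colorSum n (3 * n + 3) p) j + p (j + n))
    ((hc.partialSum_mono a1).trans (le_add_of_nonneg_right (h0 _)))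
    (hle.trans (hc.partialSum_mono (by omega)))
  exact ⟨_, hc, τ, by rw [stackPath, hτ, e]⟩

end StackPath

/-! ### Passing to the handle addition -/

section Push

variable {n : ℕ} {ψ : ℕ → ℕ} {φ : ℕ → ℕ} {p p' : ℕ → ℝ} {s : Finset ℕ} {m : ℕ}

/-- The image of a point under the simplicial map given by `φ` on the vertices less than `m`. -/
def pushPoint (m : ℕ) (φ : ℕ → ℕ) (p : ℕ → ℝ) (w : ℕ) : ℝ :=
  ∑ v ∈ range m, if φ v = w then p v else 0

lemma pushPoint_of_mem (hs : s ⊆ range m) (hφ : Set.InjOn φ s) (hp : ∀ v, v ∉ s → p v = 0)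
    {v : ℕ} (hv : v ∈ s) : pushPoint m φ p (φ v) = p v := by
  rw [pushPoint, sum_eq_single v, if_pos rfl]
  · intro b _ hb
    rw [ite_eq_right_iff]
    intro h
    by_contra hb'
    have : b ∈ s := not_not.1 fun h' => hb' (hp b h')
    exact hb (hφ this hv h)
  · exact fun h => (h (hs hv)).elim

lemma pushPoint_of_notMem (hp : ∀ v, v ∉ s → p v = 0) {w : ℕ} (hw : w ∉ s.image φ) :
    pushPoint m φ p w = 0 := by
  refine sum_eq_zero fun v _ => ?_
  rw [ite_eq_right_iff]
  rintro rfl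
  exact hp v fun hv => hw (mem_image_of_mem _ hv)

lemma pushPoint_mem
    (H : IsHandleIdentification (Delta n (2 * n + 2)) (firstFacet n) (lastFacet n) ψ)
    (hn : 2 ≤ n) (hp : p ∈ realization (openDelta n)) :
    pushPoint (3 * n + 3) (identMap (lastFacet n) ψ) p ∈
      realization (handleAddition (Delta n (2 * n + 2)) (firstFacet n) (lastFacet n) ψ) := by
  obtain ⟨s, hs, h0, h1, hsum⟩ := mem_realization.1 hp
  obtain ⟨hsΔ, hF, hG⟩ := mem_openDelta.1 hs
  refine mem_realization.2 ⟨_, H.mem_faces.2 ⟨s, hsΔ, hF, hG, rfl⟩, fun w => ?_, fun w hw => ?_, ?_⟩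
  · exact sum_nonneg fun v _ => by split_ifs <;> simp [h0 v]
  · exact pushPoint_of_notMem h1 hw
  · rw [sum_image (H.injOn hsΔ), ← hsum]
    exact sum_congr rfl fun v hv =>
      pushPoint_of_mem (subset_range_of_mem hn hsΔ) (H.injOn hsΔ) h1 hv

lemma exists_pushPoint_eq
    (H : IsHandleIdentification (Delta n (2 * n + 2)) (firstFacet n) (lastFacet n) ψ)
    (hn : 2 ≤ n) {y : ℕ → ℝ} (hy : y ∈
    realization (handleAddition (Delta n (2 * n + 2)) (firstFacet n) (lastFacet n) ψ)) :
    ∃ p ∈ realization (openDelta n), pushPoint (3 * n + 3) (identMap (lastFacet n) ψ) p = y := by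
  obtain ⟨t, ht, h0, h1, hsum⟩ := mem_realization.1 hy
  obtain ⟨s, hsΔ, hF, hG, rfl⟩ := H.mem_faces.1 ht
  let p : ℕ → ℝ := fun v => if v ∈ s then y (identMap (lastFacet n) ψ v) else 0
  have hp : ∀ v, v ∉ s → p v = 0 := fun v hv => if_neg hv
  refine ⟨p, mem_realization.2 ⟨s, mem_openDelta.2 ⟨hsΔ, hF, hG⟩, fun v => ?_, hp, ?_⟩, ?_⟩
  · simp only [p]
    split_ifs
    · exact h0 _
    · exact le_rfl
  · rw [← hsum, sum_image (H.injOn hsΔ)]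
    exact sum_congr rfl fun v hv => if_pos hv
  · ext w
    by_cases hw : w ∈ s.image (identMap (lastFacet n) ψ)
    · obtain ⟨v, hv, rfl⟩ := mem_image.1 hw
      rw [pushPoint_of_mem (subset_range_of_mem hn hsΔ) (H.injOn hsΔ) hp hv]
      exact if_pos hv
    · rw [pushPoint_of_notMem hp hw, h1 w hw]

/-- The fibres of the identification, on the realization. -/
lemma pushPoint_eq_iff
    (H : IsHandleIdentification (Delta n (2 * n + 2)) (firstFacet n) (lastFacet n) ψ)
    (hn : 2 ≤ n) (hp : p ∈ realization (openDelta n))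
    (hp' : p' ∈ realization (openDelta n))
    (h : pushPoint (3 * n + 3) (identMap (lastFacet n) ψ) p =
      pushPoint (3 * n + 3) (identMap (lastFacet n) ψ) p') :
    p = p' ∨ ((∀ v, p v ≠ 0 → v ∈ firstFacet n) ∧ (∀ v, p' v ≠ 0 → v ∈ lastFacet n)) ∨
      ((∀ v, p' v ≠ 0 → v ∈ firstFacet n) ∧ (∀ v, p v ≠ 0 → v ∈ lastFacet n)) := by
  -- The support of a point is a face whose image is the support of the image point, so fibres over
  -- points reduce to `image_eq_image` for faces.
  have key : ∀ {p : ℕ → ℝ}, p ∈ realization (openDelta n) →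
      ∃ σ ∈ (Delta n (2 * n + 2)).faces, (∀ v, v ∈ σ ↔ p v ≠ 0) ∧
        σ.image (identMap (lastFacet n) ψ) = ((range (3 * n + 3)).filter fun w =>
          pushPoint (3 * n + 3) (identMap (lastFacet n) ψ) p w ≠ 0) := by
    intro p hp
    obtain ⟨s, hs, h0, h1, hsum⟩ := mem_realization.1 hp
    obtain ⟨hsΔ, hF, hG⟩ := mem_openDelta.1 hs
    have hσ : ∀ v, v ∈ s.filter (fun v => p v ≠ 0) ↔ p v ≠ 0 := fun v => by
      rw [mem_filter, and_iff_right_iff_imp]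
      exact fun hv => not_not.1 fun hvs => hv (h1 v hvs)
    have hσΔ : s.filter (fun v => p v ≠ 0) ∈ (Delta n (2 * n + 2)).faces := by
      refine ((Delta n (2 * n + 2)).isRelLowerSet_faces hsΔ).2 (filter_subset _ _) ?_
      rw [nonempty_iff_ne_empty]
      intro h
      rw [← sum_filter_ne_zero, h, sum_empty] at hsum
      exact zero_ne_one hsum
    have hp0 : ∀ v, v ∉ s.filter (fun v => p v ≠ 0) → p v = 0 := fun v hv =>
      not_not.1 fun h => hv ((hσ v).2 h)
    refine ⟨_, hσΔ, hσ, ?_⟩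
    ext w
    rw [mem_filter]
    constructor
    · intro hw
      obtain ⟨v, hv, rfl⟩ := mem_image.1 hw
      rw [pushPoint_of_mem (subset_range_of_mem hn hσΔ) (H.injOn hσΔ) hp0 hv]
      refine ⟨?_, (hσ v).1 hv⟩
      have h2 := mem_range.1 (subset_range_of_mem hn hσΔ hv)
      rw [mem_range, identMap]
      split_ifs with hvG
      · have := mem_firstFacet.1 (H.map_mem hvG); omega
      · exact h2
    · rintro ⟨-, hw⟩
      by_contra hw'
      exact hw (pushPoint_of_notMem hp0 hw')
  obtain ⟨σ, hσΔ, hσ, e⟩ := key hp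
  obtain ⟨σ', hσΔ', hσ', e'⟩ := key hp'
  rw [h, ← e'] at e
  have hp0 : ∀ v, v ∉ σ → p v = 0 := fun v hv => not_not.1 fun h => hv ((hσ v).2 h)
  have hp0' : ∀ v, v ∉ σ' → p' v = 0 := fun v hv => not_not.1 fun h => hv ((hσ' v).2 h)
  rcases H.image_eq_image hσΔ hσΔ' e with rfl | ⟨h1, h2⟩ | ⟨h1, h2⟩
  · left
    ext v
    by_cases hv : v ∈ σ
    · rw [← pushPoint_of_mem (subset_range_of_mem hn hσΔ) (H.injOn hσΔ) hp0 hv, h,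
        pushPoint_of_mem (subset_range_of_mem hn hσΔ) (H.injOn hσΔ) hp0' hv]
    · rw [hp0 v hv, hp0' v hv]
  · exact Or.inr (Or.inr ⟨fun v hv => h2 ((hσ' v).2 hv), fun v hv => h1 ((hσ v).2 hv)⟩)
  · exact Or.inr (Or.inl ⟨fun v hv => h2 ((hσ v).2 hv), fun v hv => h1 ((hσ' v).2 hv)⟩)

end Push

/-! ### The gluing of the two ends of the cylinder -/

section HandlePath

variable {n : ℕ} [NeZero n] {ψ : ℕ → ℕ} {c c' : ZMod n → ℝ} {π : Equiv.Perm (ZMod n)}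

/-- The image of `stackPath c τ` in the realization of the handle addition. -/
noncomputable def handlePath (n : ℕ) (ψ : ℕ → ℕ) (c : ZMod n → ℝ) (τ : ℝ) : ℕ → ℝ :=
  pushPoint (3 * n + 3) (identMap (lastFacet n) ψ) (stackPath c τ)

/-- Both points lie on the identified facet; their coordinates at `ψ v` are `c (π v)` and `c' v`,
and `lastFacet n` represents every colour. -/
lemma handlePath_zero_eq_one
    (H : IsHandleIdentification (Delta n (2 * n + 2)) (firstFacet n) (lastFacet n) ψ)
    (hn : 2 ≤ n) (hπ : ∀ v ∈ lastFacet n, (ψ v : ZMod n) = π v)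
    (hc : IsBoundaryPoint c) (hc' : IsBoundaryPoint c') :
    handlePath n ψ c 0 = handlePath n ψ c' 1 ↔ c' = c ∘ π := by
  have hF := H.left_facet.1
  have hG := H.right_facet.1
  have h0 : ∀ v, v ∉ firstFacet n → stackPath c 0 v = 0 := fun v hv => by
    rw [hc.stackPath_zero hn, if_neg hv]
  have h1 : ∀ v, v ∉ lastFacet n → stackPath c' 1 v = 0 := fun v hv => by
    rw [hc'.stackPath_one hn, if_neg hv]
  have e0 : ∀ v ∈ lastFacet n, handlePath n ψ c 0 (ψ v) = c (π v) := fun v hv => by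
    have h2 := H.map_mem hv
    have h3 := pushPoint_of_mem (subset_range_of_mem hn hF) (H.injOn hF) h0 h2
    rw [H.identMap_left h2, hc.stackPath_zero hn, if_pos h2, hπ v hv] at h3
    exact h3
  have e1 : ∀ v ∈ lastFacet n, handlePath n ψ c' 1 (ψ v) = c' v := fun v hv => by
    have h3 := pushPoint_of_mem (subset_range_of_mem hn hG) (H.injOn hG) h1 hv
    rw [identMap, if_pos hv, hc'.stackPath_one hn, if_pos hv] at h3
    exact h3
  constructor
  · intro h
    ext k
    obtain ⟨v, hv1, hv2, rfl⟩ := exists_natCast_zmod (2 * n + 3) k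
    have hv : v ∈ lastFacet n := mem_lastFacet.2 (by omega)
    rw [← e1 v hv, ← h, e0 v hv]; rfl
  · rintro rfl
    ext w
    by_cases hw : w ∈ firstFacet n
    · have hw' := hw
      rw [← H.image_facet] at hw'
      obtain ⟨v, hv, rfl⟩ := mem_image.1 hw'
      rw [e0 v hv, e1 v hv]; rfl
    · rw [handlePath, handlePath,
        pushPoint_of_notMem h0 (by rwa [H.image_left subset_rfl]),
        pushPoint_of_notMem h1 (by rwa [image_identMap subset_rfl, H.image_facet])]

lemma handlePath_eq_iff
    (H : IsHandleIdentification (Delta n (2 * n + 2)) (firstFacet n) (lastFacet n) ψ)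
    (hn : 2 ≤ n) (hπ : ∀ v ∈ lastFacet n, (ψ v : ZMod n) = π v)
    (hc : IsBoundaryPoint c) (hc' : IsBoundaryPoint c') {τ τ' : unitInterval} :
    handlePath n ψ c τ = handlePath n ψ c' τ' ↔
      (c = c' ∧ τ = τ') ∨ (τ = 0 ∧ τ' = 1 ∧ c' = c ∘ π) ∨ (τ' = 0 ∧ τ = 1 ∧ c = c' ∘ π) := by
  constructor
  · intro h
    rcases pushPoint_eq_iff H hn (hc.stackPath_mem hn τ) (hc'.stackPath_mem hn τ') h with
      h1 | ⟨h1, h2⟩ | ⟨h1, h2⟩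
    · exact Or.inl (hc.stackPath_injective hc' hn h1)
    · obtain rfl := hc.eq_zero_of_supp hn h1
      obtain rfl := hc'.eq_one_of_supp hn h2
      exact Or.inr (Or.inl ⟨rfl, rfl, (handlePath_zero_eq_one H hn hπ hc hc').1 h⟩)
    · obtain rfl := hc'.eq_zero_of_supp hn h1
      obtain rfl := hc.eq_one_of_supp hn h2
      exact Or.inr (Or.inr ⟨rfl, rfl, (handlePath_zero_eq_one H hn hπ hc' hc).1 h.symm⟩)
  · rintro (⟨rfl, rfl⟩ | ⟨rfl, rfl, h⟩ | ⟨rfl, rfl, h⟩)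
    · rfl
    · exact (handlePath_zero_eq_one H hn hπ hc hc').2 h
    · exact ((handlePath_zero_eq_one H hn hπ hc' hc).2 h).symm

end HandlePath

end SphereBundles
namespace SphereBundles

open Finset

/-! ### The round sphere as the boundary of a simplex -/

section HyperplaneCoordinates

/-- Coordinates on the Euclidean space that identify it with the hyperplane `∑ x_k = 0`. -/
lemma exists_hyperplaneCoordinates (n d : ℕ) [NeZero n] (hn : n = d + 1) :
    ∃ ι : EuclideanSpace ℝ (Fin d) →ₗ[ℝ] (ZMod n → ℝ),
      (∀ v w, inner ℝ v w = ∑ k, ι v k * ι w k) ∧ ∀ y : ZMod n → ℝ, ∑ k, y k = 0 ↔ ∃ w, ι w = y := by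
  have : Fact (Module.finrank ℝ (EuclideanSpace ℝ (ZMod n)) = d + 1) :=
    ⟨by rw [finrank_euclideanSpace, ZMod.card, hn]⟩
  let e : EuclideanSpace ℝ (ZMod n) := WithLp.toLp 2 fun _ => 1
  have he : e ≠ 0 := fun h => by
    have := congrFun (congrArg WithLp.ofLp h) 0
    exact one_ne_zero this
  have hinner : ∀ y : EuclideanSpace ℝ (ZMod n), inner ℝ e y = ∑ k, y k := fun y => by
    simp [PiLp.inner_apply, e]
  let L := (OrthonormalBasis.fromOrthogonalSpanSingleton (𝕜 := ℝ) d he).repr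
  let ι : EuclideanSpace ℝ (Fin d) →ₗ[ℝ] (ZMod n → ℝ) :=
    (WithLp.linearEquiv 2 ℝ (ZMod n → ℝ)).toLinearMap ∘ₗ
      (Submodule.subtype _) ∘ₗ L.symm.toLinearEquiv.toLinearMap
  have hι : ∀ w k, ι w k = (L.symm w : EuclideanSpace ℝ (ZMod n)) k := fun _ _ => rfl
  refine ⟨ι, fun v w => ?_, fun y => ⟨fun hy => ?_, ?_⟩⟩
  · rw [← L.symm.inner_map_map, Submodule.coe_inner, PiLp.inner_apply]
    refine sum_congr rfl fun k _ => ?_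
    rw [hι, hι]
    simp [mul_comm]
  · refine ⟨L ⟨WithLp.toLp 2 y, ?_⟩, ?_⟩
    · rw [Submodule.mem_orthogonal_singleton_iff_inner_right, hinner]
      exact hy
    · ext k
      rw [hι, L.symm_apply_apply]
  · rintro ⟨w, rfl⟩
    have := Submodule.mem_orthogonal_singleton_iff_inner_right.1 (L.symm w).2
    rw [hinner] at this
    exact this

end HyperplaneCoordinates

section BoundaryCoordinates

variable {n : ℕ} [NeZero n]

/-- The largest of the numbers `-y k`. -/
noncomputable def maxNeg (y : ZMod n → ℝ) : ℝ := univ.sup' univ_nonempty fun k => -y k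

/-- The radial projection of the hyperplane `∑ y_k = 0` to the boundary of the simplex. -/
noncomputable def radialPoint (y : ZMod n → ℝ) (k : ZMod n) : ℝ :=
  (y k + maxNeg y) / (n * maxNeg y)

lemma neg_le_maxNeg (y : ZMod n → ℝ) (k : ZMod n) : -y k ≤ maxNeg y :=
  le_sup' (fun k => -y k) (mem_univ k)

lemma exists_maxNeg (y : ZMod n → ℝ) : ∃ k, maxNeg y = -y k := by
  obtain ⟨k, -, hk⟩ := exists_mem_eq_sup' (univ_nonempty (α := ZMod n)) fun k => -y k
  exact ⟨k, hk⟩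

lemma maxNeg_pos {y : ZMod n → ℝ} (hy : ∑ k, y k = 0) (h0 : y ≠ 0) : 0 < maxNeg y := by
  by_contra h
  rw [not_lt] at h
  refine h0 (funext fun k => ?_)
  have hnn : ∀ k ∈ univ, 0 ≤ y k := fun k _ => by have := neg_le_maxNeg y k; linarith
  exact (sum_eq_zero_iff_of_nonneg hnn).1 hy k (mem_univ k)

lemma maxNeg_comp (y : ZMod n → ℝ) (π : Equiv.Perm (ZMod n)) : maxNeg (y ∘ π) = maxNeg y := by
  obtain ⟨k, hk⟩ := exists_maxNeg (y ∘ π)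
  obtain ⟨l, hl⟩ := exists_maxNeg y
  refine le_antisymm ?_ ?_
  · rw [hk]; exact neg_le_maxNeg y (π k)
  · rw [hl]
    have := neg_le_maxNeg (y ∘ π) (π.symm l)
    simpa using this

lemma continuous_maxNeg : Continuous (maxNeg : (ZMod n → ℝ) → ℝ) :=
  Continuous.finset_sup'_apply _ fun k _ => (continuous_apply k).neg

lemma radialPoint_comp (y : ZMod n → ℝ) (π : Equiv.Perm (ZMod n)) :
    radialPoint (y ∘ π) = radialPoint y ∘ π := by
  ext k
  simp only [radialPoint, maxNeg_comp, Function.comp_apply]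

/-- The point is the barycentre plus `y / (n * maxNeg y)`: the ray in direction `y` is followed
until the first coordinate vanishes. -/
lemma isBoundaryPoint_radialPoint {y : ZMod n → ℝ} (hy : ∑ k, y k = 0) (h0 : y ≠ 0) :
    IsBoundaryPoint (radialPoint y) := by
  have hpos := maxNeg_pos hy h0
  have hn : (0 : ℝ) < n := Nat.cast_pos.2 (NeZero.pos n)
  refine ⟨fun k => ?_, ?_, ?_⟩
  · have := neg_le_maxNeg y k
    exact div_nonneg (by linarith) (by positivity)
  · simp only [radialPoint]
    rw [← sum_div, sum_add_distrib, hy, sum_const, card_univ, ZMod.card, nsmul_eq_mul, zero_add,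
      div_self (by positivity)]
  · obtain ⟨k, hk⟩ := exists_maxNeg y
    exact ⟨k, by rw [radialPoint, hk]; simp⟩

lemma eq_smul_of_radialPoint_eq {y y' : ZMod n → ℝ} (hy : ∑ k, y k = 0) (h0 : y ≠ 0)
    (hy' : ∑ k, y' k = 0) (h0' : y' ≠ 0) (h : radialPoint y = radialPoint y') :
    y' = (maxNeg y' / maxNeg y) • y := by
  have hpos := maxNeg_pos hy h0
  have hpos' := maxNeg_pos hy' h0'
  have hn : (0 : ℝ) < n := Nat.cast_pos.2 (NeZero.pos n)
  ext k
  have hk := congrFun h k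
  rw [radialPoint, radialPoint, div_eq_div_iff (by positivity) (by positivity)] at hk
  have hk' : (n : ℝ) * (y k * maxNeg y' - y' k * maxNeg y) = 0 := by linarith
  have hk'' := (mul_eq_zero.1 hk').resolve_left hn.ne'
  rw [Pi.smul_apply, smul_eq_mul, div_mul_eq_mul_div, eq_div_iff hpos.ne']
  linarith

lemma radialPoint_smul_sub {c : ZMod n → ℝ} (hc : IsBoundaryPoint c) {r : ℝ} (hr : 0 < r) :
    radialPoint (r • fun k => c k - 1 / n) = c := by
  have hn : (0 : ℝ) < n := Nat.cast_pos.2 (NeZero.pos n)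
  have hmax : maxNeg (r • fun k => c k - 1 / n) = r / n := by
    refine le_antisymm ?_ ?_
    · obtain ⟨k, hk⟩ := exists_maxNeg (r • fun k => c k - 1 / n)
      rw [hk, Pi.smul_apply, smul_eq_mul]
      have := mul_nonneg hr.le (hc.nonneg k)
      rw [mul_sub, mul_one_div]
      linarith
    · obtain ⟨k, hk⟩ := hc.exists_zero
      refine le_trans (le_of_eq ?_) (neg_le_maxNeg _ k)
      rw [Pi.smul_apply, smul_eq_mul, hk]; ring
  ext k
  rw [radialPoint, hmax, Pi.smul_apply, smul_eq_mul]
  field_simp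
  ring

end BoundaryCoordinates

section Continuity

variable {n : ℕ}

lemma continuous_stackPath {X : Type*} [TopologicalSpace X] {c : X → ZMod n → ℝ} {τ : X → ℝ}
    (hc : Continuous c) (hτ : Continuous τ) : Continuous fun x => stackPath (c x) (τ x) := by
  have hS : ∀ v, Continuous fun x => partialSum (c x) v := fun v =>
    continuous_finsetSum _ fun l _ => (continuous_apply _).comp hc
  have hu : Continuous fun x => stackParameter (c x) (2 * n + 2) (τ x) :=
    (hS 1).add (hτ.mul ((hS _).sub (hS 1)))
  have hcl : ∀ v, Continuous fun x =>
      clampUnit (stackParameter (c x) (2 * n + 2) (τ x)) (partialSum (c x) v) := fun v =>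
    hu.max ((hS v).min (hu.add continuous_const))
  exact continuous_pi fun v => (hcl (v + 1)).sub (hcl v)

lemma continuous_handlePath {X : Type*} [TopologicalSpace X] {ψ : ℕ → ℕ} {c : X → ZMod n → ℝ}
    {τ : X → ℝ} (hc : Continuous c) (hτ : Continuous τ) :
    Continuous fun x => handlePath n ψ (c x) (τ x) := by
  have h := continuous_stackPath hc hτ
  refine continuous_pi fun w => ?_
  simp only [handlePath, pushPoint]
  refine continuous_finsetSum _ fun v _ => ?_
  split_ifs
  · exact (continuous_apply v).comp h
  · exact continuous_const

end Continuity

/-! ### The handle addition as a glued cylinder -/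

section Gluing

variable {n : ℕ} [NeZero n]

/-- The realization of a handle addition to `Delta n (2 * n + 2)` is glued from `S^(n-2) × [0, 1]`
by a permutation of the coordinates. -/
lemma exists_isGluing_handleAddition {ψ : ℕ → ℕ} {π : Equiv.Perm (ZMod n)}
    (H : IsHandleIdentification (Delta n (2 * n + 2)) (firstFacet n) (lastFacet n) ψ)
    (hn : 2 ≤ n) (hπ : ∀ v ∈ lastFacet n, (ψ v : ZMod n) = π v)
    {W : Type*} [NormedAddCommGroup W] [InnerProductSpace ℝ W] [FiniteDimensional ℝ W]
    (ι : W →ₗ[ℝ] (ZMod n → ℝ)) (hinner : ∀ v w, inner ℝ v w = ∑ k, ι v k * ι w k)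
    (hrange : ∀ y : ZMod n → ℝ, ∑ k, y k = 0 ↔ ∃ w, ι w = y) {A : W ≃ₗᵢ[ℝ] W}
    (hA : IsPermIsometry ι π A) :
    ∃ q : Metric.sphere (0 : W) 1 × unitInterval →
      realization (handleAddition (Delta n (2 * n + 2)) (firstFacet n) (lastFacet n) ψ),
      IsGluing (sphereMap A) q := by
  have : ProperSpace W := FiniteDimensional.proper ℝ W
  have hinj : Function.Injective ι := by
    refine (injective_iff_map_eq_zero ι).2 fun w hw => ?_
    have := hinner w w
    rw [hw] at this
    simpa using this
  have hι0 : ∀ w : Metric.sphere (0 : W) 1, ι w ≠ 0 := fun w h => by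
    have h1 : (w : W) = 0 := hinj (by rw [h, map_zero])
    have h2 := w.2
    rw [h1] at h2
    simp at h2
  have hιs : ∀ w, ∑ k, ι w k = 0 := fun w => (hrange _).2 ⟨w, rfl⟩
  have hb : ∀ w : Metric.sphere (0 : W) 1, IsBoundaryPoint (radialPoint (ι w)) := fun w =>
    isBoundaryPoint_radialPoint (hιs w) (hι0 w)
  have hιc : Continuous ι := ι.continuous_of_finiteDimensional
  have hinj' : ∀ w w' : Metric.sphere (0 : W) 1, radialPoint (ι w) = radialPoint (ι w') →
      w = w' := by
    intro w w' h
    have h1 := eq_smul_of_radialPoint_eq (hιs w) (hι0 w) (hιs w') (hι0 w') h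
    rw [← map_smul] at h1
    have h2 := hinj h1
    have h3 := congrArg norm h2
    have hp := div_pos (maxNeg_pos (hιs w') (hι0 w')) (maxNeg_pos (hιs w) (hι0 w))
    rw [norm_smul, norm_eq_of_mem_sphere, norm_eq_of_mem_sphere, mul_one, Real.norm_of_nonneg hp.le]
      at h3
    rw [← h3, one_smul] at h2
    exact Subtype.ext h2.symm
  have hsurj : ∀ c : ZMod n → ℝ, IsBoundaryPoint c →
      ∃ w : Metric.sphere (0 : W) 1, radialPoint (ι w) = c := by
    intro c hc
    have hn0 : (0 : ℝ) < n := Nat.cast_pos.2 (NeZero.pos n)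
    obtain ⟨w, hw⟩ := (hrange fun k => c k - 1 / n).1 (by
      rw [sum_sub_distrib, hc.sum_eq, sum_const, card_univ, ZMod.card, nsmul_eq_mul,
        mul_one_div_cancel hn0.ne', sub_self])
    have hw0 : w ≠ 0 := fun h => by
      obtain ⟨k, hk⟩ := hc.exists_zero
      have h1 := congrFun hw k
      rw [h, map_zero, hk, Pi.zero_apply] at h1
      have : (0 : ℝ) < 1 / n := by positivity
      linarith
    refine ⟨⟨‖w‖⁻¹ • w, ?_⟩, ?_⟩
    · rw [mem_sphere_zero_iff_norm, norm_smul, norm_inv, norm_norm,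
        inv_mul_cancel₀ (norm_ne_zero_iff.2 hw0)]
    · rw [map_smul, hw]
      exact radialPoint_smul_sub hc (inv_pos.2 (norm_pos_iff.2 hw0))
  have hcont : Continuous fun a : Metric.sphere (0 : W) 1 × unitInterval =>
      radialPoint (ι a.1) := by
    have h1 : Continuous fun a : Metric.sphere (0 : W) 1 × unitInterval => ι a.1 :=
      hιc.comp (continuous_subtype_val.comp continuous_fst)
    have h2 := continuous_maxNeg.comp h1
    refine continuous_pi fun k => (((continuous_apply k).comp h1).add h2).div
      (continuous_const.mul h2) fun a => ?_
    have := maxNeg_pos (hιs a.1) (hι0 a.1)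
    have hn0 : (0 : ℝ) < n := Nat.cast_pos.2 (NeZero.pos n)
    exact (mul_pos hn0 this).ne'
  refine ⟨fun a => ⟨handlePath n ψ (radialPoint (ι a.1)) a.2,
    pushPoint_mem H hn ((hb a.1).stackPath_mem hn a.2)⟩, .of_continuous ?_ ?_ ?_⟩
  · exact Continuous.subtype_mk (continuous_handlePath hcont
      (continuous_subtype_val.comp continuous_snd)) _
  · rintro ⟨y, hy⟩
    obtain ⟨p, hp, rfl⟩ := exists_pushPoint_eq H hn hy
    obtain ⟨c, hc, τ, rfl⟩ := exists_stackPath_eq hn hp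
    obtain ⟨w, rfl⟩ := hsurj c hc
    exact ⟨(w, τ), rfl⟩
  -- Radial projection commutes with coordinate permutations, so the relation between the ends
  -- becomes the isometry `A`.
  · have hAw : ∀ w w' : Metric.sphere (0 : W) 1,
        radialPoint (ι w') = radialPoint (ι w) ∘ π ↔ w' = sphereMap A w := by
      intro w w'
      rw [← radialPoint_comp, show ι w ∘ π = ι (sphereMap A w) from
        funext fun k => (hA w k).symm]
      exact ⟨hinj' _ _, fun h => by rw [h]⟩
    rintro ⟨w, τ⟩ ⟨w', τ'⟩
    rw [Subtype.ext_iff]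
    refine (handlePath_eq_iff H hn hπ (hb w) (hb w')).trans ?_
    rw [hAw, hAw, Prod.mk.injEq]
    exact or_congr (and_congr_left fun _ => ⟨hinj' _ _, fun h => by rw [h]⟩) Iff.rfl

end Gluing

/-! ### Parity of the colour permutations and the resulting spaces -/

section Triangulations

/-- The permutation of the residues modulo `n` induced by the straight identification. -/
def straightPerm (n : ℕ) : Equiv.Perm (ZMod n) := (Equiv.addRight (1 : ZMod n))⁻¹ ^ 2

/-- The permutation of the residues modulo `n` induced by the exchanged identification. -/
def exchangedPerm (n : ℕ) : Equiv.Perm (ZMod n) := Equiv.swap (-1) 0 * straightPerm n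

variable {n : ℕ}

/-- Modulo `n`, subtracting `2n + 2` is subtracting `2`; in the form of a square the permutation is
visibly even for every `n`. -/
lemma straightIdent_eq {v : ℕ} (hv : v ∈ lastFacet n) :
    (straightIdent n v : ZMod n) = straightPerm n v := by
  rw [mem_lastFacet] at hv
  rw [straightIdent, Nat.cast_sub (by omega), straightPerm, sq, Equiv.Perm.mul_apply]
  have : (Equiv.addRight (1 : ZMod n))⁻¹ = Equiv.addRight (-1) := by
    ext k; simp
  rw [this]
  simp only [Equiv.coe_addRight]
  push_cast
  rw [ZMod.natCast_self]
  ring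

/-- The numbers `1, …, n` have distinct residues, so exchanging `n - 1` and `n` amounts to
exchanging `-1` and `0`. -/
lemma exchangedIdent_eq (hn : 2 ≤ n) {v : ℕ} (hv : v ∈ lastFacet n) :
    (exchangedIdent n v : ZMod n) = exchangedPerm n v := by
  rw [exchangedPerm, Equiv.Perm.mul_apply, ← straightIdent_eq hv, exchangedIdent]
  have hmem : straightIdent n v ∈ firstFacet n := bijOn_straightIdent.mapsTo hv
  rw [mem_firstFacet] at hmem
  have h1 : ((n - 1 : ℕ) : ZMod n) = -1 := by
    rw [Nat.cast_sub (by omega), ZMod.natCast_self]; simp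
  generalize straightIdent n v = x at hmem
  by_cases hx : x = n - 1
  · rw [hx, h1, Equiv.swap_apply_left, Equiv.swap_apply_left, ZMod.natCast_self]
  · by_cases hx' : x = n
    · rw [hx', ZMod.natCast_self, Equiv.swap_apply_right, Equiv.swap_apply_right, h1]
    · rw [Equiv.swap_apply_of_ne_of_ne hx hx', Equiv.swap_apply_of_ne_of_ne]
      · rw [← h1]
        intro h
        have := natCast_zmod_cases h
        omega
      · rw [← ZMod.natCast_self n]
        intro h
        have := natCast_zmod_cases h
        omega

lemma sign_straightPerm [NeZero n] : Equiv.Perm.sign (straightPerm n) = 1 := by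
  rw [straightPerm, map_pow, Int.units_sq]

lemma sign_exchangedPerm [NeZero n] (hn : 2 ≤ n) : Equiv.Perm.sign (exchangedPerm n) = -1 := by
  have : Fact (1 < n) := ⟨hn⟩
  rw [exchangedPerm, Equiv.Perm.sign_mul, Equiv.Perm.sign_swap (by simp), sign_straightPerm,
    mul_one]

/-- A handle addition to `Delta n (2 * n + 2)` is glued by the identity or by any given
reflection, according to the sign of the permutation of the residues. -/
lemma exists_isGluing_of_sign {m : ℕ} {ψ : ℕ → ℕ} {π : Equiv.Perm (ZMod (m + 2))} (hm : 1 ≤ m)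
    (H : IsHandleIdentification (Delta (m + 2) (2 * (m + 2) + 2)) (firstFacet (m + 2))
      (lastFacet (m + 2)) ψ)
    (hπ : ∀ v ∈ lastFacet (m + 2), (ψ v : ZMod (m + 2)) = π v)
    {e : EuclideanSpace ℝ (Fin (m + 1))} (he : e ≠ 0) :
    ∃ q : Sphere m × unitInterval → realization (handleAddition (Delta (m + 2) (2 * (m + 2) + 2))
      (firstFacet (m + 2)) (lastFacet (m + 2)) ψ),
      IsGluing (sphereMap (if Equiv.Perm.sign π = 1 then 1 else hyperplaneReflection e)) q := by
  obtain ⟨ι, hinner, hrange⟩ := exists_hyperplaneCoordinates (m + 2) (m + 1) rfl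
  have hrank : 1 < Module.rank ℝ (EuclideanSpace ℝ (Fin (m + 1))) := by
    rw [← Module.finrank_eq_rank, finrank_euclideanSpace, Fintype.card_fin]
    exact_mod_cast (by omega : 1 < m + 1)
  obtain ⟨A, hA, hiso⟩ := exists_isPermIsometry hrank ι hinner (fun y => (hrange y).1) he π
  obtain ⟨q, hq⟩ := exists_isGluing_handleAddition H (by omega) hπ ι hinner hrange hA
  exact hq.of_isotopicIsometry hiso

lemma isTriangulation_straightISS {m : ℕ} (hm : 1 ≤ m) :
    IsTriangulation (straightISS (m + 2)) (Sphere m × Circle) := by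
  obtain ⟨q, hq⟩ := exists_isGluing_of_sign hm (isHandleIdentification_straight (by omega))
    (fun v hv => straightIdent_eq hv) (e := EuclideanSpace.single 0 1) (by simp)
  rw [if_pos sign_straightPerm] at hq
  exact IsGluing.circle_homeomorph hq

lemma hyperplaneReflection_single {m : ℕ} (x : EuclideanSpace ℝ (Fin (m + 1))) (j : Fin (m + 1)) :
    hyperplaneReflection (EuclideanSpace.single 0 1) x j = if j = 0 then - x 0 else x j := by
  rw [hyperplaneReflection_apply]
  simp only [EuclideanSpace.inner_single_left, PiLp.norm_single, PiLp.sub_apply, PiLp.smul_apply,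
    PiLp.single_apply]
  split_ifs with h
  · rw [h]; simp; ring
  · simp

lemma triangulates_exchangedISS {m : ℕ} (hm : 1 ≤ m) :
    TriangulatesNonorientableSphereBundle m (exchangedISS (m + 2)) := by
  have H := isHandleIdentification_exchanged (n := m + 2) (by omega)
  obtain ⟨q, hq⟩ := exists_isGluing_of_sign hm H
    (fun v hv => exchangedIdent_eq (by omega) hv) (e := EuclideanSpace.single 0 1) (by simp)
  rw [if_neg (by rw [sign_exchangedPerm (by omega)]; decide)] at hq
  refine ⟨hq.nonempty_homeomorph (isGluing_twistRel m fun x y => ?_), hq.isSphereBundleOverCircle,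
    not_isOrientable_handleAddition H (by omega) ?_ ?_⟩
  · rw [← Subtype.coe_inj]
    constructor
    · intro h
      rw [h]
      refine ⟨?_, fun j hj => ?_⟩
      · rw [sphereMap_apply, hyperplaneReflection_single, if_pos rfl]
      · rw [sphereMap_apply, hyperplaneReflection_single, if_neg hj]
    · rintro ⟨h0, h1⟩
      ext j
      rw [sphereMap_apply, hyperplaneReflection_single]
      split_ifs with hj
      · rw [hj, h0]
      · exact h1 j hj
  · rw [exchangedIdent, straightIdent, Equiv.swap_apply_of_ne_of_ne] <;> omega
  · rw [orientationSign_delta (by omega) H, inversionSign_exchanged (by omega), neg_neg]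

end Triangulations

end SphereBundles

/-! ### The theorem -/

theorem mainTheorem5 :
    -- the construction from the stacked sphere `Δ_(2n+2)`
    (∀ n : ℕ, 3 ≤ n →
      SphereBundles.IsStackedSphere n (SphereBundles.Delta n (2 * n + 2)) ∧
      SphereBundles.IsHandleIdentification (SphereBundles.Delta n (2 * n + 2))
        (SphereBundles.firstFacet n) (SphereBundles.lastFacet n)
        (SphereBundles.straightIdent n) ∧
      SphereBundles.IsHandleIdentification (SphereBundles.Delta n (2 * n + 2))
        (SphereBundles.firstFacet n) (SphereBundles.lastFacet n)
        (SphereBundles.exchangedIdent n) ∧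
      (∃ ε : Finset ℕ → ℤˣ,
        SphereBundles.IsCoherentOrientation n (SphereBundles.Delta n (2 * n + 2)) ε ∧
        SphereBundles.orientationSign ε (SphereBundles.lastFacet n)
          (SphereBundles.straightIdent n) = -1 ∧
        SphereBundles.orientationSign ε (SphereBundles.lastFacet n)
          (SphereBundles.exchangedIdent n) = 1) ∧
      (SphereBundles.vertices (SphereBundles.straightISS n)).ncard = 2 * n + 2 ∧
      SphereBundles.IsTriangulation (SphereBundles.straightISS n)
        (SphereBundles.Sphere (n - 2) × Circle) ∧
      (SphereBundles.vertices (SphereBundles.exchangedISS n)).ncard = 2 * n + 2 ∧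
      SphereBundles.TriangulatesNonorientableSphereBundle (n - 2)
        (SphereBundles.exchangedISS n)) ∧
    -- triangulations of `S^(2k) × S^1` with `4k + 6` vertices
    (∀ k : ℕ, 1 ≤ k → ∃ K : PreAbstractSimplicialComplex ℕ,
      (SphereBundles.vertices K).ncard = 4 * k + 6 ∧
      SphereBundles.IsTriangulation K (SphereBundles.Sphere (2 * k) × Circle)) ∧
    -- triangulations of the nonorientable `S^(2k+1)`-bundle over `S^1` with `4k + 8` vertices
    (∀ k : ℕ, ∃ K : PreAbstractSimplicialComplex ℕ,
      (SphereBundles.vertices K).ncard = 4 * k + 8 ∧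
      SphereBundles.TriangulatesNonorientableSphereBundle (2 * k + 1) K) := by
  refine ⟨fun n hn => ?_, fun k hk => ?_, fun k => ?_⟩
  · obtain ⟨m, rfl⟩ : ∃ m, n = m + 2 := ⟨n - 2, by omega⟩
    have hs := SphereBundles.isHandleIdentification_straight (n := m + 2) (by omega)
    have he := SphereBundles.isHandleIdentification_exchanged (n := m + 2) (by omega)
    refine ⟨SphereBundles.isStackedSphere_delta (by omega) (by omega), hs, he,
      ⟨_, SphereBundles.isCoherentOrientation_delta (by omega) (by omega), ?_, ?_⟩,
      SphereBundles.ncard_vertices_handleAddition (by omega) hs,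
      SphereBundles.isTriangulation_straightISS (by omega),
      SphereBundles.ncard_vertices_handleAddition (by omega) he,
      SphereBundles.triangulates_exchangedISS (by omega)⟩
    · rw [SphereBundles.orientationSign_delta (by omega) hs, SphereBundles.inversionSign_straight]
    · rw [SphereBundles.orientationSign_delta (by omega) he,
        SphereBundles.inversionSign_exchanged (by omega), neg_neg]
  · refine ⟨SphereBundles.straightISS (2 * k + 2), ?_,
      SphereBundles.isTriangulation_straightISS (by omega)⟩
    rw [SphereBundles.straightISS, SphereBundles.ncard_vertices_handleAddition (by omega)
      (SphereBundles.isHandleIdentification_straight (by omega))]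
    ring
  · refine ⟨SphereBundles.exchangedISS (2 * k + 1 + 2), ?_,
      SphereBundles.triangulates_exchangedISS (by omega)⟩
    rw [SphereBundles.exchangedISS, SphereBundles.ncard_vertices_handleAddition (by omega)
      (SphereBundles.isHandleIdentification_exchanged (by omega))]
    ring
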